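/- Let $m\ge 0$ be an integer and let $\rho:\mathbb R^2\to\mathbb R$ be smooth and compactly supported, with $$\int_{\mathbb R^2}\rho(x)\,x_1^{a}x_2^{b}\,dx=0\qquad\text{for all integers } a,b\ge 0,\ a+b\le m .$$ Let $$\varphi(x)=\int_{\mathbb R^2}\frac{\rho(y)}{2\pi|x-y|}\,dy$$ be its 2D Coulomb potential (the kernel $1/(2\pi|x|)$ is the fundamental solution of $\sqrt{-\Delta}$); the integral converges absolutely for every $x$. For $L>0$ with $\operatorname{supp}\rho\subset\Omega_L:=[-L,L]^2$ and an even integer $N\ge 2$ put $h=2L/N$, $\mu_p=\pi p/(2L)$, and let $$\varphi_N(x)=\sum_{p=1}^{N-1}\sum_{q=1}^{N-1}\frac{\hat\rho^{\,s}_{pq}}{\sqrt{\mu_p^2+\mu_q^2}}\,\sin(\mu_p(x_1+L))\sin(\mu_q(x_2+L)),$$ $$\hat\rho^{\,s}_{pq}=\frac1{L^2}\int_{\Omega_L}\rho(x)\sin(\mu_p(x_1+L))\sin(\mu_q(x_2+L))\,dx$$ be the sine spectral approximation of the solution of $\sqrt{-\Delta}\,\tilde\varphi=\rho$ in $\Omega_L$,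 $\tilde\varphi=0$ on $\partial\Omega_L$. Write $\|f\|_{\infty(\Omega_L)}=\sup_{x\in\Omega_L}|f(x)|$. Then the error is $O(L^{-(m+2)})$ up to the spectrally small mesh error: (i) There is a constant $C>0$ depending only on $\rho$ and $m$, and for every integer $k\ge1$ a constant $D_k>0$ depending only on $\rho$, $m$ and $k$, such that for all such $L$ and $N$ $$\|\varphi-\varphi_N\|_{\infty(\Omega_L)}\le C\,L^{-(m+2)}+D_k\,h^{k}.$$ (ii) Consequently, as soon as the mesh resolves $\rho$, the error is $O(L^{-(m+2)})$: for every $\varepsilon>0$ there is a constant $C_\varepsilon>0$ depending only on $\rho$, $m$ and $\varepsilon$ such that $$\|\varphi-\varphi_N\|_{\infty(\Omega_L)}\le C_\varepsilon\,L^{-(m+2)}$$ for all such $L$ and $N$ with $h\le L^{-\varepsilon}$; in particular, for each $L$, for all sufficiently large even $N$, with a constant independent of $L$ and $N$. -/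

import Mathlib

open MeasureTheory

noncomputable section

/-- The closed square `[-L, L]²`. -/
def box (L : ℝ) : Set (EuclideanSpace ℝ (Fin 2)) :=
  {x | ∀ i, x i ∈ Set.Icc (-L) L}

/-- The Coulomb kernel `U(x) = 1 / (2 π |x|)` in the plane (`|x|` is the Euclidean norm). -/
def coulombKernel (x : EuclideanSpace ℝ (Fin 2)) : ℝ :=
  1 / (2 * Real.pi * ‖x‖)

/-- The potential `φ = U * ρ`. -/
def coulombPotential (ρ : EuclideanSpace ℝ (Fin 2) → ℝ) (x : EuclideanSpace ℝ (Fin 2)) : ℝ :=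
  ∫ y, coulombKernel (x - y) * ρ y

/-- All moments of `ρ` of total order at most `m` vanish. -/
def VanishingMoments (m : ℕ) (ρ : EuclideanSpace ℝ (Fin 2) → ℝ) : Prop :=
  ∀ a b : ℕ, a + b ≤ m → ∫ x, ρ x * (x 0 ^ a * x 1 ^ b) = 0

/-- The frequency `μ_p = π p / (2 L)`. -/
def sineFreq (L : ℝ) (p : ℕ) : ℝ :=
  Real.pi * p / (2 * L)

/-- The basis function `sin (μ_p (x₁ + L)) sin (μ_q (x₂ + L))`, which vanishes on the boundary
of `[-L, L]²`. -/
def sineMode (L : ℝ) (p q : ℕ) (x : EuclideanSpace ℝ (Fin 2)) : ℝ :=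
  Real.sin (sineFreq L p * (x 0 + L)) * Real.sin (sineFreq L q * (x 1 + L))

/-- The sine coefficient `L⁻² ∫_{[-L,L]²} ρ(x) sin (μ_p (x₁ + L)) sin (μ_q (x₂ + L)) dx`. -/
def sineCoeff (ρ : EuclideanSpace ℝ (Fin 2) → ℝ) (L : ℝ) (p q : ℕ) : ℝ :=
  1 / L ^ 2 * ∫ x in box L, ρ x * sineMode L p q x

/-- The multiplier of `√(-Δ)` on the mode `(p, q)`. -/
def sqrtLaplaceSymbol (L : ℝ) (p q : ℕ) : ℝ :=
  Real.sqrt (sineFreq L p ^ 2 + sineFreq L q ^ 2)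

/-- The sine spectral solution `φ_N` of `√(-Δ) φ = ρ` on `[-L, L]²` with homogeneous Dirichlet
boundary condition. -/
def sineSolution (ρ : EuclideanSpace ℝ (Fin 2) → ℝ) (L : ℝ) (N : ℕ)
    (x : EuclideanSpace ℝ (Fin 2)) : ℝ :=
  ∑ p ∈ Finset.Icc 1 (N - 1), ∑ q ∈ Finset.Icc 1 (N - 1),
    sineCoeff ρ L p q / sqrtLaplaceSymbol L p q * sineMode L p q x

/-- The mesh size `h = 2 L / N`. -/
def meshSize (L : ℝ) (N : ℕ) : ℝ :=
  2 * L / N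

/-- `sup_{x ∈ Ω} |f x|`, as an extended nonnegative real (so that it is `∞` if `f` is
unbounded on `Ω`). -/
def supNormOn (Ω : Set (EuclideanSpace ℝ (Fin 2))) (f : EuclideanSpace ℝ (Fin 2) → ℝ) : ENNReal :=
  ⨆ x ∈ Ω, ENNReal.ofReal |f x|

end

/-! The error splits at the untruncated sine series `sineSeries`: one part is due to the bounded
domain, the other to the mesh. Domain part. By `1/√λ = (2/√π) ∫₀^∞ exp(-λσ²) dσ`, both inverse
square roots of the Laplacian are integrals over `σ` of heat kernels at time `σ²`: the planar one
for `φ`, the Dirichlet one for the sine series. After scaling to `[-1,1]²`, the difference is `1/L`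
times an integral of `ρ(y)` against the difference of the two heat kernels at `(x/L, y/L)`. As `ρ`
lives near the centre, every image source stays away from `y/L`, even for `x` on the boundary. So
the kernel difference is a power series in `y/L` on `|yᵢ/L| ≤ 1/8`, with majorant `C/(1+σ²)` uniform
in `x` (`exists_monomialSumBound_heat_sub`). Vanishing moments remove the monomials of degree at
most `m`, and the others gain `(8R/L)^(m+1)` (`MonomialSumBound.abs_integral_le`). Integrating in
`σ` and using the factor `1/L` gives `L^(-(m+2))`. Mesh part. Integration by parts makes the sine
coefficients decay faster than any power of the frequency, with constants independent of `L`;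
summing over the discarded modes gives `O(h^k)` (`exists_tail_majorant`). -/

/-! ### Majorant calculus for power series on a square. -/

/-- `F` is, on the square `|y|, |z| ≤ r`, the sum of a family of monomials whose suprema over the
square add up to at most `B`. -/
def MonomialSumBound (r B : ℝ) (F : ℝ → ℝ → ℝ) : Prop :=
  ∃ (ι : Type) (_ : Countable ι) (a : ι → ℝ) (n k : ι → ℕ),
    Summable (fun i => |a i| * r ^ (n i + k i)) ∧ ∑' i, |a i| * r ^ (n i + k i) ≤ B ∧
    ∀ y z, |y| ≤ r → |z| ≤ r → HasSum (fun i => a i * (y ^ n i * z ^ k i)) (F y z)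

namespace MonomialSumBound

variable {r B B' : ℝ} {F G : ℝ → ℝ → ℝ}

lemma mono (h : MonomialSumBound r B F) (hB : B ≤ B') : MonomialSumBound r B' F := by
  obtain ⟨ι, hι, a, n, k, h1, h2, h3⟩ := h
  exact ⟨ι, hι, a, n, k, h1, h2.trans hB, h3⟩

lemma congr (h : MonomialSumBound r B F) (hFG : ∀ y z, F y z = G y z) :
    MonomialSumBound r B G := by
  obtain rfl : F = G := by ext y z; exact hFG y z
  exact h

lemma swap (h : MonomialSumBound r B F) : MonomialSumBound r B (fun y z => F z y) := by
  obtain ⟨ι, hι, a, n, k, h1, h2, h3⟩ := h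
  refine ⟨ι, hι, a, k, n, ?_, ?_, ?_⟩
  · simpa only [add_comm] using h1
  · simpa only [add_comm] using h2
  · intro y z hy hz
    simpa only [mul_comm] using h3 z y hz hy

lemma const_mul (h : MonomialSumBound r B F) (c : ℝ) :
    MonomialSumBound r (|c| * B) (fun y z => c * F y z) := by
  obtain ⟨ι, hι, a, n, k, h1, h2, h3⟩ := h
  refine ⟨ι, hι, fun i => c * a i, n, k, ?_, ?_, ?_⟩
  · simpa only [abs_mul, mul_assoc] using h1.mul_left |c|
  · simp only [abs_mul, mul_assoc]
    rw [tsum_mul_left]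
    gcongr
  · intro y z hy hz
    simpa only [mul_assoc] using (h3 y z hy hz).mul_left c

lemma neg (h : MonomialSumBound r B F) : MonomialSumBound r B (fun y z => - F y z) := by
  simpa using h.const_mul (-1)

/-- Majorants are countably subadditive, so the image series and the sine series can be estimated
term by term. Allowing any countable index type with repeated monomials avoids collecting
coefficients. -/
lemma hasSum {β : Type} [Countable β] {f : β → ℝ → ℝ → ℝ} {b : β → ℝ} (hr : 0 ≤ r)
    (hf : ∀ i, MonomialSumBound r (b i) (f i)) (hb : Summable b) (hB : ∑' i, b i ≤ B)
    (hF : ∀ y z, |y| ≤ r → |z| ≤ r → HasSum (fun i => f i y z) (F y z)) :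
    MonomialSumBound r B F := by
  choose ι hι a n k h1 h2 h3 using hf
  have hpos : ∀ i j, 0 ≤ |a i j| * r ^ (n i j + k i j) := fun i j => by positivity
  have hb0 : ∀ i, 0 ≤ b i := fun i => (tsum_nonneg (hpos i)).trans (h2 i)
  have hsT : Summable fun i => ∑' j, |a i j| * r ^ (n i j + k i j) :=
    Summable.of_nonneg_of_le (fun i => tsum_nonneg (hpos i)) h2 hb
  have hs : Summable fun p : (Σ i, ι i) => |a p.1 p.2| * r ^ (n p.1 p.2 + k p.1 p.2) :=
    (summable_sigma_of_nonneg fun p => hpos p.1 p.2).2 ⟨h1, hsT⟩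
  refine ⟨Σ i, ι i, inferInstance, fun p => a p.1 p.2, fun p => n p.1 p.2, fun p => k p.1 p.2,
    hs, ?_, ?_⟩
  · rw [hs.tsum_sigma' h1]
    exact (hsT.tsum_le_tsum h2 hb).trans hB
  · intro y z hy hz
    refine HasSum.sigma_of_hasSum (hF y z hy hz) (fun i => h3 i y z hy hz) ?_
    refine Summable.of_norm_bounded hs fun p => ?_
    rw [Real.norm_eq_abs, abs_mul, abs_mul, abs_pow, abs_pow, pow_add]
    gcongr

lemma add (hr : 0 ≤ r) (hF : MonomialSumBound r B F) (hG : MonomialSumBound r B' G) :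
    MonomialSumBound r (B + B') (fun y z => F y z + G y z) := by
  refine hasSum (β := Bool) (f := fun i => cond i F G) (b := fun i => cond i B B') hr ?_
    (Summable.of_finite) ?_ ?_
  · rintro (_ | _)
    · exact hG
    · exact hF
  · simp [tsum_fintype]
  · intro y z _ _
    have := hasSum_fintype (fun i : Bool => (cond i F G) y z)
    simpa using this

lemma mul (hr : 0 ≤ r) (hF : MonomialSumBound r B F) (hG : MonomialSumBound r B' G) :
    MonomialSumBound r (B * B') (fun y z => F y z * G y z) := by
  obtain ⟨ι, hι, a, n, k, h1, h2, h3⟩ := hF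
  obtain ⟨ι', hι', a', n', k', h1', h2', h3'⟩ := hG
  have hpos : ∀ i, 0 ≤ |a i| * r ^ (n i + k i) := fun i => by positivity
  have hpos' : ∀ i, 0 ≤ |a' i| * r ^ (n' i + k' i) := fun i => by positivity
  have hs := h1.mul_of_nonneg h1' hpos hpos'
  have he : ∀ p : ι × ι', |a p.1 * a' p.2| * r ^ ((n p.1 + n' p.2) + (k p.1 + k' p.2)) =
      (|a p.1| * r ^ (n p.1 + k p.1)) * (|a' p.2| * r ^ (n' p.2 + k' p.2)) := by
    intro p
    rw [abs_mul]
    ring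
  refine ⟨ι × ι', inferInstance, fun p => a p.1 * a' p.2, fun p => n p.1 + n' p.2,
    fun p => k p.1 + k' p.2, ?_, ?_, ?_⟩
  · simpa only [he] using hs
  · simp only [he]
    rw [← h1.tsum_mul_tsum h1' hs]
    exact mul_le_mul h2 h2' (tsum_nonneg hpos') ((tsum_nonneg hpos).trans h2)
  · intro y z hy hz
    have e : ∀ p : ι × ι', a p.1 * a' p.2 * (y ^ (n p.1 + n' p.2) * z ^ (k p.1 + k' p.2)) =
      (a p.1 * (y ^ n p.1 * z ^ k p.1)) * (a' p.2 * (y ^ n' p.2 * z ^ k' p.2)) := fun p => by ring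
    simp only [e]
    refine (h3 y z hy hz).mul (h3' y z hy hz) ?_
    refine Summable.of_norm_bounded hs fun p => ?_
    simp only [Real.norm_eq_abs, abs_mul, abs_pow, pow_add]
    gcongr

/-- Integrating against a function with vanishing moments supported in a square `|yᵢ| ≤ R`
gains the factor `(R / (r L)) ^ (m + 1)`. -/
lemma abs_integral_le (hF : MonomialSumBound r B F) (hr : 0 < r) {m : ℕ}
    {ρ : EuclideanSpace ℝ (Fin 2) → ℝ} (hρ : Continuous ρ) (hcompact : HasCompactSupport ρ)
    (hmoments : VanishingMoments m ρ) {R L : ℝ} (hL : 0 < L) (hR : 0 ≤ R) (hRL : R ≤ r * L)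
    (hsupp : ∀ y i, ρ y ≠ 0 → |y i| ≤ R) :
    |∫ y, ρ y * F (y 0 / L) (y 1 / L)| ≤ (∫ y, |ρ y|) * B * (R / (r * L)) ^ (m + 1) := by
  obtain ⟨ι, hι, a, n, k, h1, h2, h3⟩ := hF
  have hpos : ∀ i, 0 ≤ |a i| * r ^ (n i + k i) := fun i => by positivity
  set θ := R / (r * L) with hθ
  have hθ0 : 0 ≤ θ := by positivity
  have hθ1 : θ ≤ 1 := by rw [hθ, div_le_one (by positivity)]; exact hRL
  have hρi : Integrable ρ := hρ.integrable_of_hasCompactSupport hcompact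
  have hyL : ∀ y i, ρ y ≠ 0 → |y i / L| ≤ r * θ := by
    intro y i h
    rw [abs_div, abs_of_pos hL, div_le_iff₀ hL, hθ]
    have : r * (R / (r * L)) * L = R := by field_simp
    rw [this]
    exact hsupp y i h
  have hyr : ∀ y i, ρ y ≠ 0 → |y i / L| ≤ r := fun y i h =>
    (hyL y i h).trans (mul_le_of_le_one_right hr.le hθ1)
  set t : ι → EuclideanSpace ℝ (Fin 2) → ℝ :=
    fun i y => ρ y * (a i * ((y 0 / L) ^ n i * (y 1 / L) ^ k i)) with ht
  have hint : ∀ i, Integrable (t i) := fun i =>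
    Continuous.integrable_of_hasCompactSupport (by fun_prop) hcompact.mul_right
  have hbd : ∀ i y, ‖t i y‖ ≤ |ρ y| * (|a i| * (r ^ (n i + k i) * θ ^ (n i + k i))) := by
    intro i y
    by_cases h : ρ y = 0
    · simp [ht, h]
    · simp only [ht, Real.norm_eq_abs, abs_mul, abs_pow, ← mul_pow]
      rw [pow_add]
      gcongr
      exacts [hyL y 0 h, hyL y 1 h]
  have hnorm : ∀ i, ∫ y, ‖t i y‖ ≤
      (∫ y, |ρ y|) * (|a i| * (r ^ (n i + k i) * θ ^ (n i + k i))) := by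
    intro i
    rw [← integral_mul_const]
    exact integral_mono (hint i).norm (hρi.abs.mul_const _) (hbd i)
  have hI : 0 ≤ ∫ y, |ρ y| := integral_nonneg fun y => abs_nonneg _
  have hsum : Summable fun i => ∫ y, ‖t i y‖ := by
    refine Summable.of_nonneg_of_le (fun i => integral_nonneg fun y => norm_nonneg _)
      (fun i => (hnorm i).trans ?_) (h1.mul_left (∫ y, |ρ y|))
    gcongr
    exact mul_le_of_le_one_right (by positivity) (pow_le_one₀ hθ0 hθ1)
  have hS := hasSum_integral_of_summable_integral_norm hint hsum
  have hval : ∀ y, ∑' i, t i y = ρ y * F (y 0 / L) (y 1 / L) := by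
    intro y
    by_cases h : ρ y = 0
    · simp [ht, h]
    · exact ((h3 _ _ (hyr y 0 h) (hyr y 1 h)).mul_left (ρ y)).tsum_eq
  simp only [hval] at hS
  have hterm : ∀ i, ‖∫ y, t i y‖ ≤
      (∫ y, |ρ y|) * θ ^ (m + 1) * (|a i| * r ^ (n i + k i)) := by
    intro i
    rcases le_or_gt (n i + k i) m with h | h
    -- Low degree: the integral is a multiple of a vanishing moment. High degree (below): the
    -- support of `ρ` gives `θ ^ (n i + k i) ≤ θ ^ (m + 1)`.
    · have : ∫ y, t i y = 0 := by
        have e : ∀ y, t i y = (a i / L ^ (n i + k i)) * (ρ y * (y 0 ^ n i * y 1 ^ k i)) := by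
          intro y
          simp only [ht, div_pow, pow_add]
          field_simp
        simp only [e]
        rw [integral_const_mul, hmoments _ _ h, mul_zero]
      rw [this, norm_zero]
      positivity
    · refine (norm_integral_le_integral_norm _).trans ((hnorm i).trans ?_)
      have : θ ^ (n i + k i) ≤ θ ^ (m + 1) := pow_le_pow_of_le_one hθ0 hθ1 h
      calc (∫ y, |ρ y|) * (|a i| * (r ^ (n i + k i) * θ ^ (n i + k i)))
          ≤ (∫ y, |ρ y|) * (|a i| * (r ^ (n i + k i) * θ ^ (m + 1))) := by gcongr
        _ = _ := by ring
  have hfin := tsum_of_norm_bounded (h1.hasSum.mul_left ((∫ y, |ρ y|) * θ ^ (m + 1))) hterm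
  rw [hS.tsum_eq, Real.norm_eq_abs] at hfin
  refine hfin.trans ?_
  calc (∫ y, |ρ y|) * θ ^ (m + 1) * ∑' i, |a i| * r ^ (n i + k i)
      ≤ (∫ y, |ρ y|) * θ ^ (m + 1) * B := by gcongr
    _ = _ := by ring

end MonomialSumBound

/-! ### Majorants of exponentials, sines and Gaussians. -/

lemma monomialSumBound_exp_mul (c : ℝ) {r : ℝ} :
    MonomialSumBound r (Real.exp (|c| * r)) (fun y _ => Real.exp (c * y)) := by
  have key : ∀ x : ℝ, HasSum (fun n : ℕ => x ^ n / n.factorial) (Real.exp x) := fun x => by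
    rw [Real.exp_eq_exp_ℝ]; exact NormedSpace.expSeries_div_hasSum_exp x
  have e : ∀ n : ℕ, |c ^ n / n.factorial| * r ^ (n + 0) = (|c| * r) ^ n / n.factorial := by
    intro n
    rw [abs_div, abs_pow, Nat.abs_cast, mul_pow, add_zero]
    ring
  refine ⟨ℕ, inferInstance, fun n => c ^ n / n.factorial, fun n => n, fun _ => 0, ?_, ?_, ?_⟩
  · simpa only [e] using (key _).summable
  · simpa only [e] using (key _).tsum_eq.le
  · intro y z _ _
    convert key (c * y) using 2 with n
    rw [mul_pow]
    ring

lemma monomialSumBound_exp_mul_sq (c : ℝ) {r : ℝ} :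
    MonomialSumBound r (Real.exp (|c| * r ^ 2)) (fun y _ => Real.exp (c * y ^ 2)) := by
  have key : ∀ x : ℝ, HasSum (fun n : ℕ => x ^ n / n.factorial) (Real.exp x) := fun x => by
    rw [Real.exp_eq_exp_ℝ]; exact NormedSpace.expSeries_div_hasSum_exp x
  have e : ∀ n : ℕ, |c ^ n / n.factorial| * r ^ (2 * n + 0) =
      (|c| * r ^ 2) ^ n / n.factorial := by
    intro n
    rw [abs_div, abs_pow, Nat.abs_cast, mul_pow, add_zero, pow_mul]
    ring
  refine ⟨ℕ, inferInstance, fun n => c ^ n / n.factorial, fun n => 2 * n, fun _ => 0, ?_, ?_, ?_⟩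
  · simpa only [e] using (key _).summable
  · simpa only [e] using (key _).tsum_eq.le
  · intro y z _ _
    convert key (c * y ^ 2) using 2 with n
    rw [mul_pow, ← pow_mul]
    ring

/-- Taking the imaginary part of `exp(iδ) exp(iωy)` puts the phase into coefficients of modulus at
most `|ω|^n / n!`, so the bound is independent of `δ`. -/
lemma monomialSumBound_sin (ω δ : ℝ) {r : ℝ} (hr : 0 ≤ r) :
    MonomialSumBound r (Real.exp (|ω| * r)) (fun y _ => Real.sin (ω * y + δ)) := by
  have key : ∀ x : ℝ, HasSum (fun n : ℕ => x ^ n / n.factorial) (Real.exp x) := fun x => by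
    rw [Real.exp_eq_exp_ℝ]; exact NormedSpace.expSeries_div_hasSum_exp x
  have keyC : ∀ x : ℂ, HasSum (fun n : ℕ => x ^ n / n.factorial) (Complex.exp x) := fun x => by
    rw [Complex.exp_eq_exp_ℂ]; exact NormedSpace.expSeries_div_hasSum_exp x
  set a : ℕ → ℝ := fun n =>
    (Complex.exp (δ * Complex.I) * ((ω * Complex.I) ^ n / n.factorial)).im with ha
  have hale : ∀ n, |a n| * r ^ (n + 0) ≤ (|ω| * r) ^ n / n.factorial := by
    intro n
    have h1 : |a n| ≤ |ω| ^ n / n.factorial := by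
      refine (Complex.abs_im_le_norm _).trans ?_
      rw [norm_mul, Complex.norm_exp_ofReal_mul_I, one_mul, norm_div, norm_pow, norm_mul,
        Complex.norm_I, mul_one, Complex.norm_real, Real.norm_eq_abs, Complex.norm_natCast]
    calc |a n| * r ^ (n + 0) ≤ |ω| ^ n / n.factorial * r ^ n := by rw [add_zero]; gcongr
      _ = _ := by rw [mul_pow]; ring
  have hs : Summable fun n => |a n| * r ^ (n + 0) :=
    Summable.of_nonneg_of_le (fun n => by positivity) hale (key _).summable
  refine ⟨ℕ, inferInstance, a, fun n => n, fun _ => 0, hs, ?_, ?_⟩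
  · rw [← (key (|ω| * r)).tsum_eq]
    exact hs.tsum_le_tsum hale (key _).summable
  · intro y z _ _
    have h := Complex.hasSum_im ((keyC (ω * y * Complex.I)).mul_left (Complex.exp (δ * Complex.I)))
    have e : (Complex.exp (δ * Complex.I) * Complex.exp (ω * y * Complex.I)).im =
        Real.sin (ω * y + δ) := by
      rw [← Complex.exp_add, ← add_mul, add_comm (δ : ℂ)]
      rw [← Complex.exp_ofReal_mul_I_im]
      push_cast
      rfl
    rw [e] at h
    convert h using 2 with n
    rw [ha]
    have : (Complex.exp (δ * Complex.I) * ((ω * y * Complex.I) ^ n / n.factorial)) =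
        (Complex.exp (δ * Complex.I) * ((ω * Complex.I) ^ n / n.factorial)) * ((y ^ n : ℝ) : ℂ) := by
      push_cast
      ring
    rw [this, Complex.im_mul_ofReal]
    simp

/-- The one-dimensional Gaussian, centred at `c`, on the square `|y| ≤ r`. -/
lemma monomialSumBound_gaussian (c κ : ℝ) (hκ : 0 ≤ κ) {r : ℝ} (hr : 0 ≤ r) :
    MonomialSumBound r (Real.exp (-(c ^ 2 - 2 * |c| * r - r ^ 2) * κ))
      (fun y _ => Real.exp (-(c - y) ^ 2 * κ)) := by
  -- Expand the square: the Gaussian is `exp(-c²κ) · exp(2cκy) · exp(-κy²)`, and each factor has a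
  -- majorant.
  have h := (((monomialSumBound_exp_mul (2 * c * κ) (r := r)).mul hr
    (monomialSumBound_exp_mul_sq (-κ) (r := r))).const_mul (Real.exp (-c ^ 2 * κ)))
  refine (h.mono (le_of_eq ?_)).congr fun y z => ?_
  · rw [Real.abs_exp, ← Real.exp_add, ← Real.exp_add, abs_mul, abs_mul, abs_neg, abs_of_nonneg hκ,
      abs_two]
    ring_nf
  · rw [← Real.exp_add, ← Real.exp_add]
    ring_nf

/-! ### Heat kernels in one dimension and the method of images. -/

/-- The heat kernel of the line at time `σ ^ 2`. -/
noncomputable def heatLine (σ z : ℝ) : ℝ :=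
  1 / (2 * Real.sqrt Real.pi * σ) * Real.exp (-z ^ 2 * (1 / (4 * σ ^ 2)))

/-- The Dirichlet heat kernel of the interval `[-1, 1]` at time `σ ^ 2`, as a sine series. -/
noncomputable def heatDirichlet (σ a b : ℝ) : ℝ :=
  ∑' p : ℕ, Real.exp (-(σ * (Real.pi * p / 2)) ^ 2) *
    (Real.sin (Real.pi * p / 2 * (a + 1)) * Real.sin (Real.pi * p / 2 * (b + 1)))

lemma summable_exp_neg_sq {σ : ℝ} (hσ : 0 < σ) :
    Summable fun p : ℕ => Real.exp (-(σ * (Real.pi * p / 2)) ^ 2) := by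
  have h : Summable fun p : ℕ => Real.exp (p * (-σ ^ 2)) :=
    Real.summable_exp_nat_mul_iff.2 (by nlinarith [pow_pos hσ 2])
  refine Summable.of_nonneg_of_le (fun p => (Real.exp_pos _).le) (fun p => ?_) h
  rw [Real.exp_le_exp]
  have hp : (p : ℝ) ≤ (Real.pi * p / 2) ^ 2 := by
    have h1 : (p : ℝ) ≤ (p : ℝ) ^ 2 := by exact_mod_cast Nat.le_self_pow two_ne_zero p
    have h2 : (1 : ℝ) ≤ (Real.pi / 2) ^ 2 := by nlinarith [Real.pi_gt_three]
    calc (p : ℝ) ≤ 1 * (p : ℝ) ^ 2 := by rw [one_mul]; exact h1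
      _ ≤ (Real.pi / 2) ^ 2 * (p : ℝ) ^ 2 := by gcongr
      _ = _ := by ring
  rw [mul_pow]
  nlinarith [mul_le_mul_of_nonneg_left hp (sq_nonneg σ)]

lemma hasSum_heatDirichlet {σ : ℝ} (hσ : 0 < σ) (a b : ℝ) :
    HasSum (fun p : ℕ => Real.exp (-(σ * (Real.pi * p / 2)) ^ 2) *
      (Real.sin (Real.pi * p / 2 * (a + 1)) * Real.sin (Real.pi * p / 2 * (b + 1))))
      (heatDirichlet σ a b) := by
  refine Summable.hasSum (Summable.of_norm_bounded (summable_exp_neg_sq hσ) fun p => ?_)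
  rw [norm_mul, Real.norm_eq_abs, Real.abs_exp, norm_mul]
  refine mul_le_of_le_one_right (Real.exp_pos _).le ?_
  exact mul_le_one₀ (Real.abs_sin_le_one _) (norm_nonneg _) (Real.abs_sin_le_one _)

open HurwitzZeta in
-- Poisson summation with period 4, in the form of the functional equation of the theta kernel: `t =
-- 4/(πσ²)` goes to `1/t = πσ²/4`.
lemma hasSum_heatLine_translates {σ : ℝ} (hσ : 0 < σ) (u : ℝ) :
    HasSum (fun n : ℤ => heatLine σ (u + 4 * n))
      (1 / 4 * cosKernel ((u / 4 : ℝ) : UnitAddCircle) (Real.pi * σ ^ 2 / 4)) := by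
  have ht : 0 < 4 / (Real.pi * σ ^ 2) := by positivity
  have h := (hasSum_int_evenKernel (u / 4) ht).mul_left (1 / (2 * Real.sqrt Real.pi * σ))
  rw [evenKernel_functional_equation] at h
  convert! h using 1
  · ext n
    rw [heatLine]
    congr 2
    field_simp
    ring
  · have e : (4 / (Real.pi * σ ^ 2)) ^ (1 / 2 : ℝ) = 2 / (Real.sqrt Real.pi * σ) := by
      rw [← Real.sqrt_eq_rpow, Real.sqrt_div (by norm_num), Real.sqrt_mul Real.pi_pos.le,
        Real.sqrt_sq hσ.le]
      congr 1
      rw [show (4 : ℝ) = 2 ^ 2 by norm_num, Real.sqrt_sq (by norm_num)]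
    rw [e, one_div_div]
    have : Real.sqrt Real.pi ≠ 0 := (Real.sqrt_pos.2 Real.pi_pos).ne'
    field_simp
    ring_nf

open HurwitzZeta in
-- The product of sines is half a difference of cosines, and the constant terms of the two theta
-- series cancel.
lemma heatDirichlet_eq_cosKernel {σ : ℝ} (hσ : 0 < σ) (a b : ℝ) :
    heatDirichlet σ a b =
      1 / 4 * cosKernel (((a - b) / 4 : ℝ) : UnitAddCircle) (Real.pi * σ ^ 2 / 4) -
      1 / 4 * cosKernel (((a + b + 2) / 4 : ℝ) : UnitAddCircle) (Real.pi * σ ^ 2 / 4) := by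
  have ht : 0 < Real.pi * σ ^ 2 / 4 := by positivity
  have h := (((hasSum_nat_cosKernel₀ ((a - b) / 4) ht).sub
    (hasSum_nat_cosKernel₀ ((a + b + 2) / 4) ht)).mul_left (1 / 4))
  have h' := (hasSum_nat_add_iff' 1).2 (hasSum_heatDirichlet hσ a b)
  simp only [Finset.sum_range_one, Nat.cast_zero, mul_zero, zero_div, zero_mul, Real.sin_zero,
    sub_zero] at h'
  rw [← mul_sub]
  rw [show ∀ x y : ℝ, x - 1 - (y - 1) = x - y by intros; ring] at h
  refine h'.unique ?_
  convert! h using 2 with p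
  push_cast
  have e : -Real.pi * (p + 1) ^ 2 * (Real.pi * σ ^ 2 / 4) =
    -(σ * (Real.pi * (p + 1) / 2)) ^ 2 := by ring
  rw [e]
  have h1 := Real.cos_sub (Real.pi * (p + 1) / 2 * (a + 1)) (Real.pi * (p + 1) / 2 * (b + 1))
  have h2 := Real.cos_add (Real.pi * (p + 1) / 2 * (a + 1)) (Real.pi * (p + 1) / 2 * (b + 1))
  rw [show 2 * Real.pi * ((a - b) / 4) * (p + 1) = Real.pi * (p + 1) / 2 * (a + 1) -
    Real.pi * (p + 1) / 2 * (b + 1) by ring, h1,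
    show 2 * Real.pi * ((a + b + 2) / 4) * (p + 1) = Real.pi * (p + 1) / 2 * (a + 1) +
    Real.pi * (p + 1) / 2 * (b + 1) by ring, h2]
  ring

/-- The method of images for the Dirichlet heat kernel; the term `n = 0` of the first family is the
heat kernel of the line. -/
lemma hasSum_images {σ : ℝ} (hσ : 0 < σ) (a b : ℝ) :
    HasSum (fun n : ℤ => (if n = 0 then 0 else heatLine σ (a - b + 4 * n)) -
      heatLine σ (a + b + 2 + 4 * n)) (heatDirichlet σ a b - heatLine σ (a - b)) := by
  have h := (hasSum_ite_sub_hasSum (hasSum_heatLine_translates hσ (a - b)) 0).sub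
    (hasSum_heatLine_translates hσ (a + b + 2))
  convert! h using 1
  rw [heatDirichlet_eq_cosKernel hσ]
  simp
  ring

/-! ### Majorants of the heat kernels near the centre. -/

lemma inv_sqrt_pi_le {σ : ℝ} (hσ : 0 < σ) : 1 / (2 * Real.sqrt Real.pi * σ) ≤ 1 / σ := by
  have h : 1 ≤ Real.sqrt Real.pi := Real.one_le_sqrt.2 (by linarith [Real.pi_gt_three])
  apply one_div_le_one_div_of_le hσ
  nlinarith

lemma monomialSumBound_heatLine {σ : ℝ} (hσ : 0 < σ) (c : ℝ) {e : ℝ}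
    (he : e ≤ c ^ 2 - |c| / 4 - 1 / 64) :
    MonomialSumBound (1 / 8) (1 / σ * Real.exp (-e / (4 * σ ^ 2)))
      (fun y _ => heatLine σ (c - y)) := by
  refine ((monomialSumBound_gaussian c (1 / (4 * σ ^ 2)) (by positivity)
    (r := 1 / 8) (by norm_num)).const_mul (1 / (2 * Real.sqrt Real.pi * σ))).mono ?_
  rw [abs_of_nonneg (by positivity)]
  refine mul_le_mul (inv_sqrt_pi_le hσ) ?_ (Real.exp_pos _).le (by positivity)
  rw [Real.exp_le_exp, mul_one_div]
  apply div_le_div_of_nonneg_right _ (by positivity)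
  linarith

/-- The exponent `c² - |c|/4 - 1/64` has minimum `-1/32`, at `|c| = 1/8`. The resulting growth as `σ
→ 0` is weaker than the decay `exp(-1/(16σ²))` of the images. -/
lemma monomialSumBound_heatLine_near {σ : ℝ} (hσ : 0 < σ) (c : ℝ) :
    MonomialSumBound (1 / 8) (1 / σ * Real.exp (1 / (128 * σ ^ 2)))
      (fun y _ => heatLine σ (c - y)) := by
  refine (monomialSumBound_heatLine hσ c (e := -(1 / 32)) ?_).mono (le_of_eq ?_)
  · nlinarith [sq_nonneg (|c| - 1 / 8), sq_abs c]
  · congr 2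
    field_simp
    norm_num

/-- For `|c| ≥ 1` the exponent is at least `c²/2`, which is split in two: one half gives smallness
in `σ` from `c² ≥ 1`, the other summability in `n` from `c² ≥ n²` and `σ ≤ 1`. -/
lemma monomialSumBound_heatLine_far {σ : ℝ} (hσ : 0 < σ) (hσ1 : σ ≤ 1) {c n : ℝ} (hc : 1 ≤ |c|)
    (hn : |n| ≤ |c|) :
    MonomialSumBound (1 / 8) (1 / σ * Real.exp (-1 / (16 * σ ^ 2)) * Real.exp (-n ^ 2 / 16))
      (fun y _ => heatLine σ (c - y)) := by
  refine (monomialSumBound_heatLine hσ c (e := c ^ 2 / 2) ?_).mono ?_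
  · nlinarith [sq_abs c]
  · rw [mul_assoc, ← Real.exp_add]
    refine mul_le_mul_of_nonneg_left ?_ (by positivity)
    rw [Real.exp_le_exp]
    have h1 : 1 ≤ c ^ 2 := by nlinarith [sq_abs c]
    have h2 : n ^ 2 ≤ c ^ 2 := sq_le_sq.2 hn
    have h3 : σ ^ 2 ≤ 1 := by nlinarith
    have : -(c ^ 2 / 2) / (4 * σ ^ 2) = -c ^ 2 / (16 * σ ^ 2) + -c ^ 2 / (16 * σ ^ 2) := by
      field_simp
      ring
    rw [this]
    refine add_le_add ?_ ?_
    · apply div_le_div_of_nonneg_right _ (by positivity)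
      linarith
    · rw [neg_div, neg_div, neg_le_neg_iff]
      exact div_le_div₀ (sq_nonneg c) h2 (by positivity) (by linarith)

lemma summable_exp_neg_int_sq : Summable fun n : ℤ => Real.exp (-(n : ℝ) ^ 2 / 16) := by
  have h := (HurwitzZeta.hasSum_int_evenKernel 0 (t := 1 / (16 * Real.pi))
    (by positivity)).summable
  convert! h using 2 with n
  congr 1
  field_simp
  ring

/-- All image points `a + 4n` with `n ≠ 0`, and `-(a + 2 + 4n)`, have modulus at least 1 for `|a| ≤
1`. This makes the estimate uniform up to the boundary. -/
lemma monomialSumBound_images {σ a : ℝ} (hσ : 0 < σ) (hσ1 : σ ≤ 1) (ha : |a| ≤ 1) :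
    MonomialSumBound (1 / 8)
      (1 / σ * Real.exp (-1 / (16 * σ ^ 2)) * (2 * ∑' n : ℤ, Real.exp (-(n : ℝ) ^ 2 / 16)))
      (fun y _ => heatDirichlet σ a y - heatLine σ (a - y)) := by
  obtain ⟨ha1, ha2⟩ := abs_le.1 ha
  set w : ℤ → ℝ := fun n => 1 / σ * Real.exp (-1 / (16 * σ ^ 2)) * Real.exp (-(n : ℝ) ^ 2 / 16)
    with hw
  have hws : Summable fun n => w n + w n :=
    (summable_exp_neg_int_sq.mul_left _).add (summable_exp_neg_int_sq.mul_left _)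
  have hint : ∀ n : ℤ, n ≠ 0 → (1 : ℝ) ≤ |(n : ℝ)| := fun n hn => by
    exact_mod_cast Int.one_le_abs hn
  have hd : ∀ n : ℤ, (0 : ℝ) ≤ n ∨ (n : ℝ) ≤ -1 := fun n => by
    rcases le_or_gt 0 n with h | h
    · left; exact_mod_cast h
    · right; exact_mod_cast (by omega : n ≤ -1)
  refine MonomialSumBound.hasSum (b := fun n => w n + w n)
    (f := fun (n : ℤ) y _ => (if n = 0 then 0 else heatLine σ (a - y + 4 * n)) -
      heatLine σ (a + y + 2 + 4 * n)) (by norm_num) ?_ hws ?_ fun y z _ _ => hasSum_images hσ a y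
  · intro n
    simp only [sub_eq_add_neg]
    refine MonomialSumBound.add (by norm_num) ?_ (MonomialSumBound.neg ?_)
    · split_ifs with hn
      · have h0 : MonomialSumBound (1 / 8) (w n) (fun y _ => 0 * heatLine σ (0 - y)) :=
          ((monomialSumBound_heatLine_near hσ 0).const_mul 0).mono (by
            rw [abs_zero, zero_mul]; positivity)
        simpa using h0
      · have h1 := hint n hn
        have h4 : |(n : ℝ)| ≤ |a + 4 * n| := by
          have := abs_sub_abs_le_abs_sub (4 * (n : ℝ)) (-a)
          rw [abs_mul, abs_neg, sub_neg_eq_add, add_comm (4 * (n : ℝ))] at this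
          norm_num at this
          linarith
        refine (monomialSumBound_heatLine_far hσ hσ1 (h1.trans h4) h4).congr fun y z => ?_
        congr 1
        ring
    · have hc : 1 ≤ |-(a + 2 + 4 * n)| ∧ |(n : ℝ)| ≤ |-(a + 2 + 4 * n)| := by
        rw [abs_neg]
        rcases hd n with h | h
        · rw [abs_of_nonneg h, abs_of_nonneg (by linarith)]
          constructor <;> linarith
        · rw [abs_of_neg (by linarith : (n : ℝ) < 0), abs_of_neg (by linarith)]
          constructor <;> linarith
      refine (monomialSumBound_heatLine_far hσ hσ1 hc.1 hc.2).congr fun y z => ?_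
      simp only [heatLine]
      ring_nf
  · apply le_of_eq
    simp only [hw, ← two_mul]
    rw [tsum_mul_left, tsum_mul_left]
    ring

lemma exp_neg_le_inv {x : ℝ} (hx : 0 < x) : Real.exp (-x) ≤ 1 / x := by
  rw [Real.exp_neg, ← one_div]
  exact one_div_le_one_div_of_le hx (by linarith [Real.add_one_le_exp x])

/-- For large times the factor `exp(-σ²μ²)` beats the majorant `exp(μ/8)` of the sine and leaves
`exp(-σ²/2) exp(-p/2)`. The factor `1/σ` matches the free kernel. -/
lemma monomialSumBound_heatDirichlet {σ a : ℝ} (hσ : 1 ≤ σ) :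
    MonomialSumBound (1 / 8) (1 / σ * ∑' p : ℕ, Real.exp (p * (-(1 / 2))))
      (fun y _ => heatDirichlet σ a y) := by
  have hσ0 : 0 < σ := by linarith
  have hs : Summable fun p : ℕ => Real.exp (p * (-(1 / 2))) :=
    Real.summable_exp_nat_mul_iff.2 (by norm_num)
  refine MonomialSumBound.hasSum (b := fun p : ℕ => 1 / σ * Real.exp (p * (-(1 / 2))))
    (f := fun (p : ℕ) y _ => (Real.exp (-(σ * (Real.pi * p / 2)) ^ 2) *
      Real.sin (Real.pi * p / 2 * (a + 1))) * Real.sin (Real.pi * p / 2 * y + Real.pi * p / 2))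
    (by norm_num) ?_ (hs.mul_left _) (le_of_eq tsum_mul_left) ?_
  · intro p
    refine ((monomialSumBound_sin (Real.pi * p / 2) (Real.pi * p / 2)
      (r := 1 / 8) (by norm_num)).const_mul _).mono ?_
    rcases Nat.eq_zero_or_pos p with rfl | hp
    · simp [hσ0.le]
    · have hp' : (1 : ℝ) ≤ p := by exact_mod_cast hp
      set μ := Real.pi * p / 2 with hμ
      have hμp : 3 / 2 * (p : ℝ) ≤ μ := by rw [hμ]; nlinarith [Real.pi_gt_three]
      have hexp : Real.exp (-(σ ^ 2 / 2)) ≤ 1 / σ := by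
        rw [Real.exp_neg, ← one_div]
        apply one_div_le_one_div_of_le hσ0
        nlinarith [Real.add_one_le_exp (σ ^ 2 / 2), sq_nonneg (σ - 1)]
      rw [abs_mul, Real.abs_exp, abs_of_nonneg (by linarith : 0 ≤ μ)]
      calc Real.exp (-(σ * μ) ^ 2) * |Real.sin (μ * (a + 1))| * Real.exp (μ * (1 / 8))
          ≤ Real.exp (-(σ * μ) ^ 2) * 1 * Real.exp (μ * (1 / 8)) := by
            gcongr
            exact Real.abs_sin_le_one _
        _ = Real.exp (-(σ * μ) ^ 2 + μ * (1 / 8)) := by rw [mul_one, Real.exp_add]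
        _ ≤ Real.exp (-(σ ^ 2 / 2) + p * (-(1 / 2))) := by
            rw [Real.exp_le_exp]
            have h1 : 1 ≤ σ ^ 2 := by nlinarith
            have h2 : σ ^ 2 * μ ≤ σ ^ 2 * μ ^ 2 := by
              apply mul_le_mul_of_nonneg_left _ (sq_nonneg σ)
              nlinarith
            have h3 : σ ^ 2 / 2 * 1 ≤ σ ^ 2 / 2 * μ := by
              apply mul_le_mul_of_nonneg_left _ (by positivity)
              linarith
            have h4 : 1 / 2 * μ ≤ σ ^ 2 / 2 * μ := by
              apply mul_le_mul_of_nonneg_right _ (by linarith)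
              linarith
            rw [mul_pow]
            linarith
        _ ≤ 1 / σ * Real.exp (p * (-(1 / 2))) := by
            rw [Real.exp_add]
            gcongr
  · intro y z _ _
    convert! hasSum_heatDirichlet hσ0 a y using 2 with p
    rw [mul_assoc]
    ring_nf

/-- The difference between the heat kernel of the plane and the Dirichlet heat kernel of the square
is analytic near the centre of the square, uniformly in the other variable up to the boundary. -/
lemma exists_monomialSumBound_heat_sub :
    ∃ C : ℝ, 0 < C ∧ ∀ σ : ℝ, 0 < σ → ∀ a b : ℝ, |a| ≤ 1 → |b| ≤ 1 →
      MonomialSumBound (1 / 8) (C * (1 + σ ^ 2)⁻¹)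
        (fun y z => heatLine σ (a - y) * heatLine σ (b - z) -
          heatDirichlet σ a y * heatDirichlet σ b z) := by
  have hr : (0 : ℝ) ≤ 1 / 8 := by norm_num
  set S : ℝ := 2 * ∑' n : ℤ, Real.exp (-(n : ℝ) ^ 2 / 16) with hS
  set T : ℝ := ∑' p : ℕ, Real.exp (p * (-(1 / 2))) with hT
  have hS0 : 0 ≤ S := mul_nonneg (by norm_num) (tsum_nonneg fun n => (Real.exp_pos _).le)
  have hT0 : 0 ≤ T := tsum_nonneg fun n => (Real.exp_pos _).le
  refine ⟨2 * (40 * S + 8 * S ^ 2) + 2 * (4 + T ^ 2), by positivity,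
    fun σ hσ a b ha hb => ?_⟩
  rcases le_total σ 1 with hσ1 | hσ1
  · have g1 := monomialSumBound_heatLine_near hσ a
    have g2 := (monomialSumBound_heatLine_near hσ b).swap
    have d1 := monomialSumBound_images hσ hσ1 ha
    have d2 := (monomialSumBound_images hσ hσ1 hb).swap
    rw [← hS] at d1 d2
    -- With Dirichlet kernel `g + d`, the difference is `-(g₁d₂ + d₁g₂ + d₁d₂)`. Each term contains
    -- some `d`, whose exponential smallness absorbs both the growth of `g` and the prefactor
    -- `1/σ²`.
    refine ((((g1.mul hr d2).add hr (d1.mul hr g2)).add hr (d1.mul hr d2)).neg.mono ?_).congr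
      fun y z => ?_
    · have e1 : Real.exp (1 / (128 * σ ^ 2)) * Real.exp (-1 / (16 * σ ^ 2)) ≤ 20 * σ ^ 2 := by
        rw [← Real.exp_add]
        have : 1 / (128 * σ ^ 2) + -1 / (16 * σ ^ 2) = -(7 / (128 * σ ^ 2)) := by
          field_simp; norm_num
        rw [this]
        refine (exp_neg_le_inv (by positivity)).trans ?_
        rw [one_div_div]
        nlinarith [sq_nonneg σ]
      have e2 : Real.exp (-1 / (16 * σ ^ 2)) * Real.exp (-1 / (16 * σ ^ 2)) ≤ 8 * σ ^ 2 := by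
        rw [← Real.exp_add]
        have : -1 / (16 * σ ^ 2) + -1 / (16 * σ ^ 2) = -(1 / (8 * σ ^ 2)) := by
          field_simp; norm_num
        rw [this]
        refine (exp_neg_le_inv (by positivity)).trans ?_
        rw [one_div_div, div_one]
      set A := Real.exp (1 / (128 * σ ^ 2))
      set D := Real.exp (-1 / (16 * σ ^ 2))
      have hinv : 1 / 2 ≤ (1 + σ ^ 2)⁻¹ := by
        rw [one_div]
        exact inv_anti₀ (by positivity) (by nlinarith)
      calc 1 / σ * A * (1 / σ * D * S) + 1 / σ * D * S * (1 / σ * A) +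
            1 / σ * D * S * (1 / σ * D * S)
          = (1 / σ ^ 2) * (2 * S * (A * D) + S ^ 2 * (D * D)) := by ring
        _ ≤ (1 / σ ^ 2) * (2 * S * (20 * σ ^ 2) + S ^ 2 * (8 * σ ^ 2)) := by gcongr
        _ = (2 * (40 * S + 8 * S ^ 2)) * (1 / 2) := by field_simp; ring
        _ ≤ (2 * (40 * S + 8 * S ^ 2) + 2 * (4 + T ^ 2)) * (1 + σ ^ 2)⁻¹ := by
          apply mul_le_mul _ hinv (by norm_num) (by positivity)
          have : 0 ≤ 2 * (4 + T ^ 2) := by positivity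
          linarith
    · ring
  · have g1 := monomialSumBound_heatLine_near hσ a
    have g2 := (monomialSumBound_heatLine_near hσ b).swap
    have d1 := monomialSumBound_heatDirichlet (a := a) hσ1
    have d2 := (monomialSumBound_heatDirichlet (a := b) hσ1).swap
    rw [← hT] at d1 d2
    simp only [sub_eq_add_neg]
    -- For `σ ≥ 1` no cancellation is needed: each product alone is `O(1/σ²)`.
    refine ((g1.mul hr g2).add hr (d1.mul hr d2).neg).mono ?_
    have e1 : Real.exp (1 / (128 * σ ^ 2)) ≤ 2 := by
      have h1 : 1 / (128 * σ ^ 2) ≤ 1 / 2 := by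
        apply one_div_le_one_div_of_le (by norm_num)
        nlinarith
      have h2 : Real.exp (1 / (128 * σ ^ 2)) ≤ Real.exp (1 / 2) := Real.exp_le_exp.2 h1
      have h3 : Real.exp (1 / 2) * Real.exp (1 / 2) = Real.exp 1 := by
        rw [← Real.exp_add]; norm_num
      nlinarith [Real.exp_one_lt_d9, Real.exp_pos (1 / 2)]
    have hinv : 1 / σ ^ 2 ≤ 2 * (1 + σ ^ 2)⁻¹ := by
      rw [← div_eq_mul_inv, div_le_div_iff₀ (by positivity) (by positivity)]
      nlinarith
    set A := Real.exp (1 / (128 * σ ^ 2))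
    have hA : 0 ≤ A := (Real.exp_pos _).le
    calc 1 / σ * A * (1 / σ * A) + 1 / σ * T * (1 / σ * T) = (A * A + T ^ 2) * (1 / σ ^ 2) := by
          ring
      _ ≤ (2 * 2 + T ^ 2) * (2 * (1 + σ ^ 2)⁻¹) := by gcongr
      _ = (2 * (4 + T ^ 2)) * (1 + σ ^ 2)⁻¹ := by ring
      _ ≤ _ := by
        gcongr
        have : 0 ≤ 2 * (40 * S + 8 * S ^ 2) := by positivity
        linarith

/-! ### The Coulomb potential as an integral of heat kernels. -/

lemma heatLine_mul_heatLine (σ : ℝ) (v : EuclideanSpace ℝ (Fin 2)) :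
    heatLine σ (v 0) * heatLine σ (v 1) =
      1 / (4 * Real.pi * σ ^ 2) * Real.exp (-(1 / (4 * σ ^ 2)) * ‖v‖ ^ 2) := by
  have h : ‖v‖ ^ 2 = v 0 ^ 2 + v 1 ^ 2 := by
    rw [EuclideanSpace.real_norm_sq_eq, Fin.sum_univ_two]
  rw [h, heatLine, heatLine, mul_mul_mul_comm, ← Real.exp_add]
  have : (1 : ℝ) / (2 * Real.sqrt Real.pi * σ) * (1 / (2 * Real.sqrt Real.pi * σ)) =
      1 / (4 * Real.pi * σ ^ 2) := by
    rw [← one_div_mul_one_div_rev, ← one_div_mul_one_div_rev, ← one_div_mul_one_div_rev,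
      ← one_div_mul_one_div_rev]
    have h2 : 1 / Real.sqrt Real.pi * (1 / Real.sqrt Real.pi) = 1 / Real.pi := by
      rw [one_div_mul_one_div, Real.mul_self_sqrt Real.pi_pos.le]
    calc _ = 1 / 4 * (1 / Real.sqrt Real.pi * (1 / Real.sqrt Real.pi)) * (1 / σ) ^ 2 := by ring
      _ = _ := by rw [h2]; ring
  rw [this]
  ring_nf

lemma heatLine_div_mul (σ : ℝ) (x y : EuclideanSpace ℝ (Fin 2)) {L : ℝ} :
    heatLine σ (x 0 / L - y 0 / L) * heatLine σ (x 1 / L - y 1 / L) =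
      1 / (4 * Real.pi * σ ^ 2) * Real.exp (-(1 / (4 * σ ^ 2)) * ‖L⁻¹ • (x - y)‖ ^ 2) := by
  rw [← heatLine_mul_heatLine]
  congr 2 <;> simp <;> ring

/-- Integrating the heat kernel of the plane in `σ` gives the Coulomb kernel. -/
lemma integral_heat_eq_coulomb {v : EuclideanSpace ℝ (Fin 2)} (hv : v ≠ 0) :
    ∫ σ in Set.Ioi (0 : ℝ), 1 / (4 * Real.pi * σ ^ 2) *
      Real.exp (-(1 / (4 * σ ^ 2)) * ‖v‖ ^ 2) = Real.sqrt Real.pi / 2 * coulombKernel v := by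
  have hv' : 0 < ‖v‖ := norm_pos_iff.2 hv
  -- The substitution `τ = 1/σ` turns this into a half-line Gaussian integral.
  have h := integral_comp_rpow_Ioi
    (fun τ : ℝ => 1 / (4 * Real.pi) * Real.exp (-(‖v‖ ^ 2 / 4) * τ ^ 2)) (p := -1) (by norm_num)
  rw [integral_const_mul, integral_gaussian_Ioi] at h
  have e : ∫ σ in Set.Ioi (0 : ℝ), 1 / (4 * Real.pi * σ ^ 2) *
      Real.exp (-(1 / (4 * σ ^ 2)) * ‖v‖ ^ 2) = 1 / (4 * Real.pi) *
      (Real.sqrt (Real.pi / (‖v‖ ^ 2 / 4)) / 2) := by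
    rw [← h]
    refine setIntegral_congr_fun measurableSet_Ioi fun σ hσ => ?_
    have hσ' : (0 : ℝ) < σ := hσ
    simp only [smul_eq_mul]
    rw [abs_neg, abs_one, one_mul, Real.rpow_neg_one, show (-1 - 1 : ℝ) = -(2 : ℕ) by norm_num,
      Real.rpow_neg hσ'.le, Real.rpow_natCast]
    rw [show -(1 / (4 * σ ^ 2)) * ‖v‖ ^ 2 = -(‖v‖ ^ 2 / 4) * σ⁻¹ ^ 2 by field_simp]
    field_simp
  rw [e, coulombKernel, Real.sqrt_div Real.pi_pos.le, Real.sqrt_div (sq_nonneg _),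
    Real.sqrt_sq hv'.le, show (4 : ℝ) = 2 ^ 2 by norm_num, Real.sqrt_sq (by norm_num)]
  field_simp

lemma integral_heat_space {σ L : ℝ} (hσ : 0 < σ) (hL : 0 < L) (x : EuclideanSpace ℝ (Fin 2)) :
    Integrable (fun y : EuclideanSpace ℝ (Fin 2) =>
      heatLine σ (x 0 / L - y 0 / L) * heatLine σ (x 1 / L - y 1 / L)) ∧
    ∫ y : EuclideanSpace ℝ (Fin 2),
      heatLine σ (x 0 / L - y 0 / L) * heatLine σ (x 1 / L - y 1 / L) = L ^ 2 := by
  have hb : 0 < 1 / (4 * σ ^ 2 * L ^ 2) := by positivity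
  have hval := GaussianFourier.integral_rexp_neg_mul_sq_norm
    (V := EuclideanSpace ℝ (Fin 2)) hb
  have e : ∀ y : EuclideanSpace ℝ (Fin 2),
      heatLine σ (x 0 / L - y 0 / L) * heatLine σ (x 1 / L - y 1 / L) =
      1 / (4 * Real.pi * σ ^ 2) * Real.exp (-(1 / (4 * σ ^ 2 * L ^ 2)) * ‖x - y‖ ^ 2) := by
    intro y
    rw [heatLine_div_mul, norm_smul, mul_pow, norm_inv, inv_pow, Real.norm_eq_abs, sq_abs]
    congr 2
    field_simp
  rw [finrank_euclideanSpace, Fintype.card_fin, Nat.cast_two, div_self two_ne_zero,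
    Real.rpow_one] at hval
  have hint : Integrable fun v : EuclideanSpace ℝ (Fin 2) =>
      Real.exp (-(1 / (4 * σ ^ 2 * L ^ 2)) * ‖v‖ ^ 2) := by
    -- The integral of a non-integrable function is 0 by convention, but here its value is positive.
    by_contra hc
    rw [integral_undef hc] at hval
    have : 0 < Real.pi / (1 / (4 * σ ^ 2 * L ^ 2)) := by positivity
    linarith
  simp only [e]
  refine ⟨(hint.comp_sub_left x).const_mul _, ?_⟩
  rw [integral_const_mul, integral_sub_left_eq_self
    (fun v => Real.exp (-(1 / (4 * σ ^ 2 * L ^ 2)) * ‖v‖ ^ 2)), hval]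
  field_simp

lemma measurable_heatLine : Measurable fun p : ℝ × ℝ => heatLine p.1 p.2 := by
  unfold heatLine
  fun_prop

lemma heatLine_nonneg {σ : ℝ} (hσ : 0 < σ) (z : ℝ) : 0 ≤ heatLine σ z := by
  unfold heatLine
  positivity

section

variable {ρ : EuclideanSpace ℝ (Fin 2) → ℝ}

lemma integrable_mul_heat (hρ : Continuous ρ) (hcompact : HasCompactSupport ρ) (σ L : ℝ)
    (x : EuclideanSpace ℝ (Fin 2)) :
    Integrable fun y => ρ y * (heatLine σ (x 0 / L - y 0 / L) * heatLine σ (x 1 / L - y 1 / L)) := by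
  refine Continuous.integrable_of_hasCompactSupport ?_ hcompact.mul_right
  unfold heatLine
  fun_prop

/-- For `σ ≤ 1` use `sup |ρ|` times the mass `L²` of the kernel; for `σ ≥ 1` use `∫ |ρ|` times its
supremum, at most `1/σ²`. The constant depends on `L`, so it serves for Fubini, integrability and
the case `L = 1` only. -/
lemma exists_integral_norm_heat_le (hρ : Continuous ρ) (hcompact : HasCompactSupport ρ) {L : ℝ}
    (hL : 0 < L) :
    ∃ K : ℝ, 0 < K ∧ ∀ x : EuclideanSpace ℝ (Fin 2), ∀ σ : ℝ, 0 < σ →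
      ∫ y, ‖ρ y * (heatLine σ (x 0 / L - y 0 / L) * heatLine σ (x 1 / L - y 1 / L))‖ ≤
        K * (1 + σ ^ 2)⁻¹ := by
  obtain ⟨M, hM⟩ := hρ.bounded_above_of_compact_support hcompact
  have hM0 : 0 ≤ M := (norm_nonneg _).trans (hM 0)
  have hρi : Integrable ρ := hρ.integrable_of_hasCompactSupport hcompact
  have hI : 0 ≤ ∫ y, ‖ρ y‖ := integral_nonneg fun y => norm_nonneg _
  refine ⟨2 * (M * L ^ 2 + (∫ y, ‖ρ y‖) + 1), by positivity, fun x σ hσ => ?_⟩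
  have hint := (integrable_mul_heat hρ hcompact σ L x).norm
  have hn : ∀ y : EuclideanSpace ℝ (Fin 2),
      0 ≤ heatLine σ (x 0 / L - y 0 / L) * heatLine σ (x 1 / L - y 1 / L) := fun y =>
    mul_nonneg (heatLine_nonneg hσ _) (heatLine_nonneg hσ _)
  rcases le_total σ 1 with h1 | h1
  · have hinv : 1 / 2 ≤ (1 + σ ^ 2)⁻¹ := by
      rw [one_div]
      exact inv_anti₀ (by positivity) (by nlinarith)
    have : ∫ y, ‖ρ y * (heatLine σ (x 0 / L - y 0 / L) * heatLine σ (x 1 / L - y 1 / L))‖ ≤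
        M * L ^ 2 := by
      rw [← (integral_heat_space hσ hL x).2, ← integral_const_mul]
      refine integral_mono hint ((integral_heat_space hσ hL x).1.const_mul _) fun y => ?_
      simp only [norm_mul (ρ y)]
      rw [Real.norm_of_nonneg (hn y)]
      exact mul_le_mul_of_nonneg_right (hM y) (hn y)
    have h2 := mul_le_mul_of_nonneg_left hinv
      (by positivity : 0 ≤ 2 * (M * L ^ 2 + (∫ y, ‖ρ y‖) + 1))
    linarith
  · have hinv : 1 / σ ^ 2 ≤ 2 * (1 + σ ^ 2)⁻¹ := by
      rw [← div_eq_mul_inv, div_le_div_iff₀ (by positivity) (by positivity)]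
      nlinarith
    have : ∫ y, ‖ρ y * (heatLine σ (x 0 / L - y 0 / L) * heatLine σ (x 1 / L - y 1 / L))‖ ≤
        (∫ y, ‖ρ y‖) * (1 / σ ^ 2) := by
      rw [← integral_mul_const]
      refine integral_mono hint (hρi.norm.mul_const _) fun y => ?_
      simp only [norm_mul (ρ y)]
      refine mul_le_mul_of_nonneg_left ?_ (norm_nonneg _)
      rw [Real.norm_of_nonneg (hn y), heatLine_div_mul]
      refine (mul_le_mul_of_nonneg_left (Real.exp_le_one_iff.2 ?_) (by positivity)).trans ?_
      · rw [neg_mul, neg_nonpos]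
        positivity
      · rw [mul_one]
        apply one_div_le_one_div_of_le (by positivity)
        nlinarith [Real.pi_gt_three, sq_nonneg σ]
    have h3 : (∫ y, ‖ρ y‖) * (1 / σ ^ 2) ≤ (∫ y, ‖ρ y‖) * (2 * (1 + σ ^ 2)⁻¹) := by gcongr
    have h4 : 0 ≤ (1 + σ ^ 2)⁻¹ := by positivity
    nlinarith [mul_nonneg (mul_nonneg hM0 (sq_nonneg L)) h4]

lemma integrable_heat_prod (hρ : Continuous ρ) (hcompact : HasCompactSupport ρ) {L : ℝ}
    (hL : 0 < L) (x : EuclideanSpace ℝ (Fin 2)) :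
    Integrable (Function.uncurry fun (σ : ℝ) y =>
      ρ y * (heatLine σ (x 0 / L - y 0 / L) * heatLine σ (x 1 / L - y 1 / L)))
      ((volume.restrict (Set.Ioi 0)).prod volume) := by
  obtain ⟨K, hK, hbd⟩ := exists_integral_norm_heat_le hρ hcompact hL
  have hmeas : Measurable (Function.uncurry fun (σ : ℝ) (y : EuclideanSpace ℝ (Fin 2)) =>
      ρ y * (heatLine σ (x 0 / L - y 0 / L) * heatLine σ (x 1 / L - y 1 / L))) := by
    have h0 : ∀ i : Fin 2, Measurable fun p : ℝ × EuclideanSpace ℝ (Fin 2) =>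
        heatLine p.1 (x i / L - p.2 i / L) := fun i =>
      measurable_heatLine.comp (by fun_prop :
        Measurable fun p : ℝ × EuclideanSpace ℝ (Fin 2) => (p.1, x i / L - p.2 i / L))
    exact (hρ.measurable.comp measurable_snd).mul ((h0 0).mul (h0 1))
  rw [integrable_prod_iff hmeas.aestronglyMeasurable]
  refine ⟨Filter.Eventually.of_forall fun σ => integrable_mul_heat hρ hcompact σ L x, ?_⟩
  refine Integrable.mono' ((integrable_inv_one_add_sq.const_mul K).restrict)
    (hmeas.aestronglyMeasurable.norm.integral_prod_right') ?_
  refine (ae_restrict_iff' measurableSet_Ioi).2 (Filter.Eventually.of_forall fun σ hσ => ?_)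
  rw [Real.norm_of_nonneg (integral_nonneg fun y => norm_nonneg _)]
  exact hbd x σ hσ

lemma ae_integral_heat_eq {L : ℝ} (hL : 0 < L) (x : EuclideanSpace ℝ (Fin 2)) :
    ∀ᵐ y : EuclideanSpace ℝ (Fin 2), ∫ σ in Set.Ioi (0 : ℝ),
      ρ y * (heatLine σ (x 0 / L - y 0 / L) * heatLine σ (x 1 / L - y 1 / L)) =
      L * (Real.sqrt Real.pi / 2) * (coulombKernel (x - y) * ρ y) := by
  filter_upwards [(Set.countable_singleton x).ae_notMem volume] with y hy
  have hv : L⁻¹ • (x - y) ≠ 0 :=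
    smul_ne_zero (inv_ne_zero hL.ne') (sub_ne_zero.2 fun h => hy h.symm)
  rw [integral_const_mul]
  simp only [heatLine_div_mul]
  rw [integral_heat_eq_coulomb hv, coulombKernel, coulombKernel, norm_smul, norm_inv,
    Real.norm_of_nonneg hL.le]
  rw [show 1 / (2 * Real.pi * (L⁻¹ * ‖x - y‖)) = L * (1 / (2 * Real.pi * ‖x - y‖)) by
    rw [mul_left_comm, one_div, mul_inv, inv_inv, one_div]]
  ring

lemma integrable_coulombKernel_mul (hρ : Continuous ρ) (hcompact : HasCompactSupport ρ)
    (x : EuclideanSpace ℝ (Fin 2)) : Integrable fun y => coulombKernel (x - y) * ρ y := by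
  have h := (integrable_heat_prod hρ hcompact one_pos x).swap.integral_prod_left
  have h' := h.congr (ae_integral_heat_eq one_pos x)
  have hpi : Real.sqrt Real.pi ≠ 0 := (Real.sqrt_pos.2 Real.pi_pos).ne'
  refine (h'.const_mul (2 / Real.sqrt Real.pi)).congr (Filter.Eventually.of_forall fun y => ?_)
  simp only
  field_simp

lemma coulombPotential_eq_integral_heat (hρ : Continuous ρ) (hcompact : HasCompactSupport ρ)
    {L : ℝ} (hL : 0 < L) (x : EuclideanSpace ℝ (Fin 2)) :
    coulombPotential ρ x = 1 / L * (2 / Real.sqrt Real.pi) * ∫ σ in Set.Ioi (0 : ℝ), ∫ y,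
      ρ y * (heatLine σ (x 0 / L - y 0 / L) * heatLine σ (x 1 / L - y 1 / L)) := by
  rw [integral_integral_swap (integrable_heat_prod hρ hcompact hL x),
    integral_congr_ae (ae_integral_heat_eq hL x), integral_const_mul, coulombPotential]
  have hpi : Real.sqrt Real.pi ≠ 0 := (Real.sqrt_pos.2 Real.pi_pos).ne'
  field_simp

lemma integrableOn_integral_heat (hρ : Continuous ρ) (hcompact : HasCompactSupport ρ)
    {L : ℝ} (hL : 0 < L) (x : EuclideanSpace ℝ (Fin 2)) :
    IntegrableOn (fun σ : ℝ => ∫ y,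
      ρ y * (heatLine σ (x 0 / L - y 0 / L) * heatLine σ (x 1 / L - y 1 / L))) (Set.Ioi 0) :=
  (integrable_heat_prod hρ hcompact hL x).integral_prod_left

lemma abs_setIntegral_le_of_le_inv_one_add_sq {f : ℝ → ℝ} {K : ℝ}
    (hf : ∀ σ : ℝ, 0 < σ → |f σ| ≤ K * (1 + σ ^ 2)⁻¹) :
    |∫ σ in Set.Ioi (0 : ℝ), f σ| ≤ K * (Real.pi / 2) := by
  have h := norm_integral_le_of_norm_le (f := f) (μ := volume.restrict (Set.Ioi (0 : ℝ)))
    (integrable_inv_one_add_sq.const_mul K).restrict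
    ((ae_restrict_iff' measurableSet_Ioi).2 (Filter.Eventually.of_forall fun σ hσ => hf σ hσ))
  rwa [integral_const_mul, integral_Ioi_inv_one_add_sq, Real.arctan_zero, sub_zero] at h

lemma exists_abs_coulombPotential_le (hρ : Continuous ρ) (hcompact : HasCompactSupport ρ) :
    ∃ K : ℝ, 0 < K ∧ ∀ x, |coulombPotential ρ x| ≤ K := by
  obtain ⟨K, hK, hbd⟩ := exists_integral_norm_heat_le hρ hcompact one_pos
  have hpi : 0 < Real.sqrt Real.pi := Real.sqrt_pos.2 Real.pi_pos
  refine ⟨1 / 1 * (2 / Real.sqrt Real.pi) * (K * (Real.pi / 2)), by positivity, fun x => ?_⟩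
  rw [coulombPotential_eq_integral_heat hρ hcompact one_pos x, abs_mul,
    abs_of_nonneg (by positivity : 0 ≤ 1 / 1 * (2 / Real.sqrt Real.pi))]
  refine mul_le_mul_of_nonneg_left (abs_setIntegral_le_of_le_inv_one_add_sq fun σ hσ => ?_)
    (by positivity)
  exact (norm_integral_le_integral_norm _).trans (hbd x σ hσ)

end

/-! ### Decay of the sine coefficients by integration by parts. -/

/-- The second partial derivative in the `i`-th coordinate. -/
noncomputable def secondPartial (i : Fin 2) (ρ : EuclideanSpace ℝ (Fin 2) → ℝ) :
    EuclideanSpace ℝ (Fin 2) → ℝ :=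
  fun y => fderiv ℝ (fun y => fderiv ℝ ρ y (EuclideanSpace.single i 1)) y
    (EuclideanSpace.single i 1)

section

variable {ρ g : EuclideanSpace ℝ (Fin 2) → ℝ}

lemma contDiff_fderiv_apply_const (hρ : ContDiff ℝ (⊤ : ℕ∞) ρ) (v : EuclideanSpace ℝ (Fin 2)) :
    ContDiff ℝ (⊤ : ℕ∞) fun y => fderiv ℝ ρ y v :=
  (hρ.fderiv_right (m := (⊤ : ℕ∞)) (by exact_mod_cast le_top)).clm_apply contDiff_const

lemma hasCompactSupport_fderiv_apply (hρ : HasCompactSupport ρ) (v : EuclideanSpace ℝ (Fin 2)) :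
    HasCompactSupport fun y => fderiv ℝ ρ y v :=
  hρ.fderiv_apply ℝ v

lemma contDiff_secondPartial (i : Fin 2) (hρ : ContDiff ℝ (⊤ : ℕ∞) ρ) :
    ContDiff ℝ (⊤ : ℕ∞) (secondPartial i ρ) :=
  contDiff_fderiv_apply_const (contDiff_fderiv_apply_const hρ _) _

lemma hasCompactSupport_secondPartial (i : Fin 2) (hρ : HasCompactSupport ρ) :
    HasCompactSupport (secondPartial i ρ) :=
  hasCompactSupport_fderiv_apply (hasCompactSupport_fderiv_apply hρ _) _

lemma integral_fderiv_mul (hρ : ContDiff ℝ (⊤ : ℕ∞) ρ) (hcompact : HasCompactSupport ρ)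
    (hg : ContDiff ℝ (⊤ : ℕ∞) g) (v : EuclideanSpace ℝ (Fin 2)) :
    ∫ y, fderiv ℝ ρ y v * g y = -∫ y, ρ y * fderiv ℝ g y v := by
  rw [integral_mul_fderiv_eq_neg_fderiv_mul_of_integrable, neg_neg]
  · exact ((contDiff_fderiv_apply_const hρ v).continuous.mul
      hg.continuous).integrable_of_hasCompactSupport
      (hasCompactSupport_fderiv_apply hcompact v).mul_right
  · exact (hρ.continuous.mul
      (contDiff_fderiv_apply_const hg v).continuous).integrable_of_hasCompactSupport
      hcompact.mul_right
  · exact (hρ.continuous.mul hg.continuous).integrable_of_hasCompactSupport hcompact.mul_right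
  · exact fun y _ => (hρ.differentiable (by simp)).differentiableAt
  · exact fun y _ => (hg.differentiable (by simp)).differentiableAt

lemma integral_secondPartial_mul (hρ : ContDiff ℝ (⊤ : ℕ∞) ρ) (hcompact : HasCompactSupport ρ)
    (hg : ContDiff ℝ (⊤ : ℕ∞) g) (i : Fin 2) :
    ∫ y, secondPartial i ρ y * g y = ∫ y, ρ y * secondPartial i g y := by
  unfold secondPartial
  rw [integral_fderiv_mul (contDiff_fderiv_apply_const hρ _)
    (hasCompactSupport_fderiv_apply hcompact _) hg,
    integral_fderiv_mul hρ hcompact (contDiff_fderiv_apply_const hg _), neg_neg]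

lemma fderiv_mul_apply_zero {A B A' : ℝ → ℝ} (hA : ∀ t, HasDerivAt A (A' t) t)
    (hB : Differentiable ℝ B) :
    (fun y : EuclideanSpace ℝ (Fin 2) =>
      fderiv ℝ (fun y : EuclideanSpace ℝ (Fin 2) => A (y 0) * B (y 1)) y
        (EuclideanSpace.single 0 1)) = fun y => A' (y 0) * B (y 1) := by
  funext y
  have h0 := (hA (y 0)).comp_hasFDerivAt y
    (EuclideanSpace.proj 0 : EuclideanSpace ℝ (Fin 2) →L[ℝ] ℝ).hasFDerivAt
  have h1 := (hB (y 1)).hasDerivAt.comp_hasFDerivAt y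
    (EuclideanSpace.proj 1 : EuclideanSpace ℝ (Fin 2) →L[ℝ] ℝ).hasFDerivAt
  have h := (h0.mul h1).fderiv
  have e : (fun y : EuclideanSpace ℝ (Fin 2) => A (y 0) * B (y 1)) =
    (A ∘ ⇑(EuclideanSpace.proj 0 : EuclideanSpace ℝ (Fin 2) →L[ℝ] ℝ)) *
    (B ∘ ⇑(EuclideanSpace.proj 1 : EuclideanSpace ℝ (Fin 2) →L[ℝ] ℝ)) := rfl
  rw [e, h]
  simp [mul_comm]

lemma fderiv_mul_apply_one {A B B' : ℝ → ℝ} (hB : ∀ t, HasDerivAt B (B' t) t)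
    (hA : Differentiable ℝ A) :
    (fun y : EuclideanSpace ℝ (Fin 2) =>
      fderiv ℝ (fun y : EuclideanSpace ℝ (Fin 2) => A (y 0) * B (y 1)) y
        (EuclideanSpace.single 1 1)) = fun y => A (y 0) * B' (y 1) := by
  funext y
  have h0 := (hA (y 0)).hasDerivAt.comp_hasFDerivAt y
    (EuclideanSpace.proj 0 : EuclideanSpace ℝ (Fin 2) →L[ℝ] ℝ).hasFDerivAt
  have h1 := (hB (y 1)).comp_hasFDerivAt y
    (EuclideanSpace.proj 1 : EuclideanSpace ℝ (Fin 2) →L[ℝ] ℝ).hasFDerivAt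
  have h := (h0.mul h1).fderiv
  have e : (fun y : EuclideanSpace ℝ (Fin 2) => A (y 0) * B (y 1)) =
    (A ∘ ⇑(EuclideanSpace.proj 0 : EuclideanSpace ℝ (Fin 2) →L[ℝ] ℝ)) *
    (B ∘ ⇑(EuclideanSpace.proj 1 : EuclideanSpace ℝ (Fin 2) →L[ℝ] ℝ)) := rfl
  rw [e, h]
  simp

lemma hasDerivAt_sin_affine (ω L t : ℝ) :
    HasDerivAt (fun t => Real.sin (ω * (t + L))) (ω * Real.cos (ω * (t + L))) t := by
  have h := (((hasDerivAt_id t).add_const L).const_mul ω).sin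
  simpa [mul_comm] using h

lemma hasDerivAt_cos_affine (ω L t : ℝ) :
    HasDerivAt (fun t => ω * Real.cos (ω * (t + L))) (-ω ^ 2 * Real.sin (ω * (t + L))) t := by
  have h := ((((hasDerivAt_id t).add_const L).const_mul ω).cos).const_mul ω
  convert! h using 1
  simp
  ring

lemma secondPartial_sineMode (L : ℝ) (p q : ℕ) (i : Fin 2) (y : EuclideanSpace ℝ (Fin 2)) :
    secondPartial i (sineMode L p q) y = -sineFreq L (![p, q] i) ^ 2 * sineMode L p q y := by
  have hd : ∀ ω : ℝ, Differentiable ℝ fun t => Real.sin (ω * (t + L)) := fun ω t =>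
    (hasDerivAt_sin_affine ω L t).differentiableAt
  unfold secondPartial
  fin_cases i
  · have h1 := fderiv_mul_apply_zero (hasDerivAt_sin_affine (sineFreq L p) L) (hd (sineFreq L q))
    have h2 := fderiv_mul_apply_zero (hasDerivAt_cos_affine (sineFreq L p) L) (hd (sineFreq L q))
    have h3 := congrFun h2 y
    rw [← h1] at h3
    refine h3.trans ?_
    simp [sineMode, mul_assoc]
  · have h1 := fderiv_mul_apply_one (hasDerivAt_sin_affine (sineFreq L q) L) (hd (sineFreq L p))
    have h2 := fderiv_mul_apply_one (hasDerivAt_cos_affine (sineFreq L q) L) (hd (sineFreq L p))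
    have h3 := congrFun h2 y
    rw [← h1] at h3
    refine h3.trans ?_
    simp [sineMode]
    ring

lemma contDiff_sineMode (L : ℝ) (p q : ℕ) : ContDiff ℝ (⊤ : ℕ∞) (sineMode L p q) := by
  have h : ∀ i : Fin 2, ContDiff ℝ (⊤ : ℕ∞) fun y : EuclideanSpace ℝ (Fin 2) => y i := fun i =>
    (EuclideanSpace.proj i : EuclideanSpace ℝ (Fin 2) →L[ℝ] ℝ).contDiff
  unfold sineMode
  exact ((contDiff_const.mul ((h 0).add contDiff_const)).sin).mul
    ((contDiff_const.mul ((h 1).add contDiff_const)).sin)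

lemma abs_sineMode_le_one (L : ℝ) (p q : ℕ) (x : EuclideanSpace ℝ (Fin 2)) :
    |sineMode L p q x| ≤ 1 := by
  rw [sineMode, abs_mul]
  exact mul_le_one₀ (Real.abs_sin_le_one _) (abs_nonneg _) (Real.abs_sin_le_one _)

lemma integral_secondPartial_mul_sineMode (hρ : ContDiff ℝ (⊤ : ℕ∞) ρ)
    (hcompact : HasCompactSupport ρ) (L : ℝ) (p q : ℕ) (i : Fin 2) :
    ∫ y, secondPartial i ρ y * sineMode L p q y =
      -sineFreq L (![p, q] i) ^ 2 * ∫ y, ρ y * sineMode L p q y := by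
  rw [integral_secondPartial_mul hρ hcompact (contDiff_sineMode L p q), ← integral_const_mul]
  congr 1 with y
  rw [secondPartial_sineMode]
  ring

/-- Each pair of derivatives moved onto `ρ` yields a factor `μ²`, so the induction must range over
all `ρ`. The constant is free of `L` because the modes are bounded by 1. -/
lemma exists_integral_mul_sineMode_mul_pow_le (i : Fin 2) (k : ℕ) :
    ∀ ρ : EuclideanSpace ℝ (Fin 2) → ℝ, ContDiff ℝ (⊤ : ℕ∞) ρ → HasCompactSupport ρ →
      ∃ C : ℝ, 0 ≤ C ∧ ∀ (L : ℝ) (p q : ℕ),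
        |∫ y, ρ y * sineMode L p q y| * sineFreq L (![p, q] i) ^ (2 * k) ≤ C := by
  induction k with
  | zero =>
    intro ρ hρ hcompact
    have hρi : Integrable ρ := hρ.continuous.integrable_of_hasCompactSupport hcompact
    refine ⟨∫ y, ‖ρ y‖, integral_nonneg fun y => norm_nonneg _, fun L p q => ?_⟩
    rw [mul_zero, pow_zero, mul_one]
    refine norm_integral_le_of_norm_le (f := fun y => ρ y * sineMode L p q y) hρi.norm (Filter.Eventually.of_forall fun y => ?_)
    rw [norm_mul]
    exact mul_le_of_le_one_right (norm_nonneg _) (abs_sineMode_le_one L p q y)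
  | succ k ih =>
    intro ρ hρ hcompact
    obtain ⟨C, hC, h⟩ := ih _ (contDiff_secondPartial i hρ)
      (hasCompactSupport_secondPartial i hcompact)
    refine ⟨C, hC, fun L p q => (le_of_eq ?_).trans (h L p q)⟩
    rw [integral_secondPartial_mul_sineMode hρ hcompact, abs_mul, abs_neg, abs_pow, sq_abs]
    ring

/-- The power of one frequency measures the truncation, while the weight `1 + μ²` makes the sum over
the other index converge. Odd `k` follow from `ω^k ≤ 1 + ω^(2k)`. -/
lemma exists_sineMode_decay (hρ : ContDiff ℝ (⊤ : ℕ∞) ρ) (hcompact : HasCompactSupport ρ)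
    (i j : Fin 2) (k : ℕ) :
    ∃ C : ℝ, 0 ≤ C ∧ ∀ (L : ℝ) (p q : ℕ), |∫ y, ρ y * sineMode L p q y| *
      (sineFreq L (![p, q] i) ^ k * (1 + sineFreq L (![p, q] j) ^ 2)) ≤ C := by
  have key : ∀ k : ℕ, ∃ C : ℝ, 0 ≤ C ∧ ∀ (L : ℝ) (p q : ℕ), |∫ y, ρ y * sineMode L p q y| *
      (sineFreq L (![p, q] i) ^ (2 * k) * (1 + sineFreq L (![p, q] j) ^ 2)) ≤ C := by
    intro k
    obtain ⟨C, hC, h⟩ := exists_integral_mul_sineMode_mul_pow_le i k ρ hρ hcompact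
    obtain ⟨C', hC', h'⟩ := exists_integral_mul_sineMode_mul_pow_le i k _
      (contDiff_secondPartial j hρ) (hasCompactSupport_secondPartial j hcompact)
    refine ⟨C + C', by positivity, fun L p q => ?_⟩
    have h1 := h L p q
    have h2 := h' L p q
    rw [integral_secondPartial_mul_sineMode hρ hcompact, abs_mul, abs_neg, abs_pow, sq_abs] at h2
    linarith
  obtain ⟨C, hC, h⟩ := key 0
  obtain ⟨C', hC', h'⟩ := key k
  refine ⟨C + C', by positivity, fun L p q => ?_⟩
  have h1 := h L p q
  have h2 := h' L p q
  set ω := sineFreq L (![p, q] i)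
  set M := |∫ y, ρ y * sineMode L p q y|
  have hω : ω ^ k ≤ 1 + ω ^ (2 * k) := by
    rw [mul_comm 2 k, pow_mul]
    nlinarith [sq_nonneg (ω ^ k - 1)]
  have hM : 0 ≤ M := abs_nonneg _
  calc M * (ω ^ k * (1 + sineFreq L (![p, q] j) ^ 2))
      ≤ M * ((1 + ω ^ (2 * k)) * (1 + sineFreq L (![p, q] j) ^ 2)) := by gcongr
    _ = M * (ω ^ (2 * 0) * (1 + sineFreq L (![p, q] j) ^ 2)) +
        M * (ω ^ (2 * k) * (1 + sineFreq L (![p, q] j) ^ 2)) := by ring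
    _ ≤ C + C' := add_le_add h1 h2

lemma sineCoeff_eq {L : ℝ} (hsupp : tsupport ρ ⊆ box L) (p q : ℕ) :
    sineCoeff ρ L p q = 1 / L ^ 2 * ∫ y, ρ y * sineMode L p q y := by
  rw [sineCoeff, setIntegral_eq_integral_of_forall_compl_eq_zero]
  intro y hy
  rw [image_eq_zero_of_notMem_tsupport fun h => hy (hsupp h), zero_mul]

end

/-! ### Summation of the discarded modes. -/

lemma sum_range_inv_one_add_sineFreq_sq_le {L : ℝ} (hL : 0 < L) (n : ℕ) :
    ∑ q ∈ Finset.range n, (1 + sineFreq L (q + 1) ^ 2)⁻¹ ≤ L := by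
  set c := Real.pi / (2 * L) with hc
  have hc0 : 0 < c := by positivity
  have hanti : AntitoneOn (fun x : ℝ => (1 + (c * x) ^ 2)⁻¹) (Set.Icc 0 (0 + (n : ℝ))) := by
    intro x hx y hy hxy
    have : 0 ≤ x := hx.1
    simp only
    gcongr
  -- Comparison with `∫ dx / (1 + (cx)²)`, at most `π / (2c) = L`.
  have h := hanti.sum_le_integral
  rw [intervalIntegral.integral_comp_mul_left (fun x => (1 + x ^ 2)⁻¹) hc0.ne',
    integral_inv_one_add_sq, zero_add, mul_zero, Real.arctan_zero, sub_zero, smul_eq_mul] at h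
  have e : ∀ q : ℕ, sineFreq L (q + 1) = c * (0 + ((q + 1 : ℕ) : ℝ)) := by
    intro q
    rw [sineFreq, hc]
    push_cast
    ring
  simp only [e]
  refine h.trans ?_
  calc c⁻¹ * Real.arctan (c * n) ≤ c⁻¹ * (Real.pi / 2) := by
        gcongr
        exact (Real.arctan_lt_pi_div_two _).le
    _ = L := by
        rw [hc]
        have := Real.pi_ne_zero
        field_simp

lemma hasSum_inv_one_add_sineFreq_sq {L : ℝ} (hL : 0 < L) :
    ∃ s ≤ L, HasSum (fun q : ℕ => if q = 0 then 0 else (1 + sineFreq L q ^ 2)⁻¹) s := by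
  have hpos : ∀ q : ℕ, 0 ≤ (1 + sineFreq L (q + 1) ^ 2)⁻¹ := fun q => by positivity
  have hs := summable_of_sum_range_le hpos (sum_range_inv_one_add_sineFreq_sq_le hL)
  refine ⟨_, Real.tsum_le_of_sum_range_le hpos (sum_range_inv_one_add_sineFreq_sq_le hL), ?_⟩
  rw [← hasSum_nat_add_iff' 1]
  simpa using hs.hasSum

lemma div_le_sineFreq {L : ℝ} (hL : 0 < L) (p : ℕ) : (p : ℝ) / L ≤ sineFreq L p := by
  rw [sineFreq, div_le_div_iff₀ hL (by positivity)]
  have hp : (0 : ℝ) ≤ p * L := by positivity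
  nlinarith [Real.pi_gt_three]

/-- Since `μ_p ≥ p/L`, keep `p⁻²` for the sum, whose tail is at most `2/N`, and bound the other
powers of `1/p` by powers of `1/N`. -/
lemma hasSum_inv_sineFreq_pow {L : ℝ} (hL : 0 < L) {N k : ℕ} (hN : 0 < N) (hk : 1 ≤ k) :
    ∃ s ≤ 2 * L * (2 * L / N) ^ k,
      HasSum (fun p : ℕ => if N ≤ p then (sineFreq L p ^ (k + 1))⁻¹ else 0) s := by
  have hN' : (0 : ℝ) < N := by exact_mod_cast hN
  have hf0 : ∀ p : ℕ, 0 ≤ sineFreq L p := fun p => by unfold sineFreq; positivity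
  have hpos : ∀ p : ℕ, 0 ≤ if N ≤ p then (sineFreq L p ^ (k + 1))⁻¹ else 0 := fun p => by
    have := hf0 p
    positivity
  obtain ⟨j, rfl⟩ : ∃ j, k = j + 1 := ⟨k - 1, by omega⟩
  have hbd : ∀ n, ∑ p ∈ Finset.range n, (if N ≤ p then (sineFreq L p ^ (j + 1 + 1))⁻¹ else 0) ≤
      2 * L * (2 * L / N) ^ (j + 1) := by
    intro n
    have h1 : ∀ p ∈ Finset.range n, (if N ≤ p then (sineFreq L p ^ (j + 1 + 1))⁻¹ else 0) ≤
        if p ∈ Finset.Ioo (N - 1) n then L ^ (j + 2) / N ^ j * ((p : ℝ) ^ 2)⁻¹ else 0 := by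
      intro p hp
      by_cases hNp : N ≤ p
      · have hmem : p ∈ Finset.Ioo (N - 1) n := by
          rw [Finset.mem_Ioo]
          have := Finset.mem_range.1 hp
          omega
        rw [if_pos hNp, if_pos hmem]
        have hp0 : (0 : ℝ) < p := by exact_mod_cast hN.trans_le hNp
        have hNp' : (N : ℝ) ≤ p := by exact_mod_cast hNp
        calc (sineFreq L p ^ (j + 1 + 1))⁻¹ ≤ (((p : ℝ) / L) ^ (j + 1 + 1))⁻¹ := by
              gcongr
              exact div_le_sineFreq hL p
          _ = L ^ (j + 2) / p ^ j * ((p : ℝ) ^ 2)⁻¹ := by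
              rw [div_pow, inv_div, pow_add (p : ℝ) j 2]
              field_simp
          _ ≤ L ^ (j + 2) / N ^ j * ((p : ℝ) ^ 2)⁻¹ := by gcongr
      · rw [if_neg hNp]
        positivity
    refine (Finset.sum_le_sum h1).trans ?_
    rw [← Finset.sum_filter, Finset.filter_mem_eq_inter, Finset.inter_eq_right.2 (fun p hp =>
      Finset.mem_range.2 (Finset.mem_Ioo.1 hp).2), ← Finset.mul_sum]
    have h2 := sum_Ioo_inv_sq_le (α := ℝ) (N - 1) n
    have h3 : ((N - 1 : ℕ) : ℝ) + 1 = N := by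
      rw [Nat.cast_sub hN]
      simp
    rw [h3] at h2
    calc L ^ (j + 2) / N ^ j * ∑ p ∈ Finset.Ioo (N - 1) n, ((p : ℝ) ^ 2)⁻¹
        ≤ L ^ (j + 2) / N ^ j * (2 / N) := by gcongr
      _ = 2 * L * (L / N) ^ (j + 1) := by
          rw [div_pow]
          field_simp
          ring
      _ ≤ 2 * L * (2 * L / N) ^ (j + 1) := by
          gcongr
          linarith
  exact ⟨_, Real.tsum_le_of_sum_range_le hpos hbd, (summable_of_sum_range_le hpos hbd).hasSum⟩

lemma sineMode_zero_left (L : ℝ) (q : ℕ) (x : EuclideanSpace ℝ (Fin 2)) :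
    sineMode L 0 q x = 0 := by
  simp [sineMode, sineFreq]

lemma sineMode_zero_right (L : ℝ) (p : ℕ) (x : EuclideanSpace ℝ (Fin 2)) :
    sineMode L p 0 x = 0 := by
  simp [sineMode, sineFreq]

/-- The sine coefficients of the solution outside the square `[1, N - 1]²` of indices have a
summable majorant of sum `O(h ^ k)`. -/
lemma exists_tail_majorant {ρ : EuclideanSpace ℝ (Fin 2) → ℝ} (hρ : ContDiff ℝ (⊤ : ℕ∞) ρ)
    (hcompact : HasCompactSupport ρ) {k : ℕ} (hk : 1 ≤ k) :
    ∃ D : ℝ, 0 < D ∧ ∀ L : ℝ, 0 < L → tsupport ρ ⊆ box L → ∀ N : ℕ, 0 < N →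
      ∃ (w : ℕ × ℕ → ℝ) (s : ℝ), HasSum w s ∧ s ≤ D * meshSize L N ^ k ∧ (∀ i, 0 ≤ w i) ∧
        ∀ p q : ℕ, (p, q) ∉ Finset.Icc 1 (N - 1) ×ˢ Finset.Icc 1 (N - 1) →
          |sineCoeff ρ L p q / sqrtLaplaceSymbol L p q| ≤ w (p, q) := by
  obtain ⟨C, hC, hdec⟩ := exists_sineMode_decay hρ hcompact 0 1 k
  obtain ⟨C', hC', hdec'⟩ := exists_sineMode_decay hρ hcompact 1 0 k
  refine ⟨2 * (C + C' + 1), by positivity, fun L hL hsupp N hN => ?_⟩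
  obtain ⟨sv, hsv, hv⟩ := hasSum_inv_one_add_sineFreq_sq hL
  obtain ⟨su, hsu, hu⟩ := hasSum_inv_sineFreq_pow hL hN hk
  set v : ℕ → ℝ := fun q => if q = 0 then 0 else (1 + sineFreq L q ^ 2)⁻¹ with hvdef
  set u : ℕ → ℝ := fun p => if N ≤ p then (sineFreq L p ^ (k + 1))⁻¹ else 0 with hudef
  have hf0 : ∀ p : ℕ, 0 ≤ sineFreq L p := fun p => by unfold sineFreq; positivity
  have hv0 : ∀ q, 0 ≤ v q := fun q => by simp only [hvdef]; positivity
  have hu0 : ∀ p, 0 ≤ u p := fun p => by have := hf0 p; simp only [hudef]; positivity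
  have hsv0 : 0 ≤ sv := hv.nonneg hv0
  have h1 : HasSum (fun i : ℕ × ℕ => u i.1 * v i.2) (su * sv) :=
    hu.mul hv (hu.summable.mul_of_nonneg hv.summable hu0 hv0)
  have h2 : HasSum (fun i : ℕ × ℕ => v i.1 * u i.2) (sv * su) :=
    hv.mul hu (hv.summable.mul_of_nonneg hu.summable hv0 hu0)
  have hN' : (0 : ℝ) < N := by exact_mod_cast hN
  -- The two families cover `N ≤ p` and `N ≤ q`. Each index sum costs a factor `L`, and these cancel
  -- the normalisation `1/L²`.
  refine ⟨_, _, ((h1.mul_left (1 / L ^ 2 * C)).add (h2.mul_left (1 / L ^ 2 * C'))), ?_, ?_, ?_⟩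
  · have hprod : su * sv ≤ 2 * L * (2 * L / N) ^ k * L :=
      mul_le_mul hsu hsv hsv0 (by positivity)
    calc 1 / L ^ 2 * C * (su * sv) + 1 / L ^ 2 * C' * (sv * su)
        = 1 / L ^ 2 * (C + C') * (su * sv) := by ring
      _ ≤ 1 / L ^ 2 * (C + C') * (2 * L * (2 * L / N) ^ k * L) := by gcongr
      _ = 2 * (C + C') * (2 * L / N) ^ k := by field_simp
      _ ≤ 2 * (C + C' + 1) * meshSize L N ^ k := by
          rw [meshSize]
          exact mul_le_mul_of_nonneg_right (by linarith) (by positivity)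
  · intro i
    have := hu0 i.1
    have := hu0 i.2
    have := hv0 i.1
    have := hv0 i.2
    positivity
  · intro p q hpq
    have hw : ∀ a b : ℕ, 0 ≤ u a * v b := fun a b => mul_nonneg (hu0 a) (hv0 b)
    have hA := hw p q
    have hB := hw q p
    rw [mul_comm (u q)] at hB
    have hLc : 0 ≤ 1 / L ^ 2 * C := by positivity
    have hLc' : 0 ≤ 1 / L ^ 2 * C' := by positivity
    rcases Nat.eq_zero_or_pos p with rfl | hp
    · have : sineCoeff ρ L 0 q = 0 := by simp [sineCoeff, sineMode_zero_left]
      rw [this, zero_div, abs_zero]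
      exact add_nonneg (mul_nonneg hLc hA) (mul_nonneg hLc' hB)
    rcases Nat.eq_zero_or_pos q with rfl | hq
    · have : sineCoeff ρ L p 0 = 0 := by simp [sineCoeff, sineMode_zero_right]
      rw [this, zero_div, abs_zero]
      exact add_nonneg (mul_nonneg hLc hA) (mul_nonneg hLc' hB)
    have hpos : ∀ p : ℕ, 0 < p → 0 < sineFreq L p := fun p hp => by
      have : (0 : ℝ) < p := by exact_mod_cast hp
      unfold sineFreq
      positivity
    have hp1 := hpos p hp
    have hq1 := hpos q hq
    have hsp : sineFreq L p ≤ sqrtLaplaceSymbol L p q :=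
      Real.le_sqrt_of_sq_le (by nlinarith [sq_nonneg (sineFreq L q)])
    have hsq : sineFreq L q ≤ sqrtLaplaceSymbol L p q :=
      Real.le_sqrt_of_sq_le (by nlinarith [sq_nonneg (sineFreq L p)])
    have hsym : 0 < sqrtLaplaceSymbol L p q := hp1.trans_le hsp
    have hd := hdec L p q
    have hd' := hdec' L p q
    simp only [Matrix.cons_val_zero, Matrix.cons_val_one] at hd hd'
    rw [sineCoeff_eq hsupp, abs_div, abs_mul, abs_of_pos hsym,
      abs_of_nonneg (by positivity : 0 ≤ 1 / L ^ 2)]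
    set M := |∫ y, ρ y * sineMode L p q y|
    have hM : 0 ≤ M := abs_nonneg _
    have main : ∀ a b c : ℝ, 0 < a → a ≤ sqrtLaplaceSymbol L p q → M * (a ^ k * (1 + b ^ 2)) ≤ c →
        1 / L ^ 2 * M / sqrtLaplaceSymbol L p q ≤
          1 / L ^ 2 * c * ((a ^ (k + 1))⁻¹ * (1 + b ^ 2)⁻¹) := by
      intro a b c ha has hc
      calc 1 / L ^ 2 * M / sqrtLaplaceSymbol L p q ≤ 1 / L ^ 2 * M / a := by gcongr
        _ = 1 / L ^ 2 * (M * (a ^ k * (1 + b ^ 2))) * ((a ^ (k + 1))⁻¹ * (1 + b ^ 2)⁻¹) := by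
            field_simp
            ring
        _ ≤ _ := by gcongr
    have hcase : N ≤ p ∨ N ≤ q := by
      by_contra! h
      exact hpq (Finset.mem_product.2 ⟨Finset.mem_Icc.2 ⟨hp, by omega⟩,
        Finset.mem_Icc.2 ⟨hq, by omega⟩⟩)
    rcases hcase with h | h
    · refine (main _ _ C hp1 hsp hd).trans (le_add_of_le_of_nonneg (le_of_eq ?_)
        (mul_nonneg hLc' hB))
      simp only [hudef, hvdef, if_pos h, if_neg hq.ne']
    · refine (main _ _ C' hq1 hsq hd').trans (le_add_of_nonneg_of_le
        (mul_nonneg hLc hA) (le_of_eq ?_))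
      simp only [hudef, hvdef, if_pos h, if_neg hp.ne', mul_comm]

/-! ### The full sine series, its mesh error and its heat representation. -/

/-- The sine spectral solution without truncation. -/
noncomputable def sineSeries (ρ : EuclideanSpace ℝ (Fin 2) → ℝ) (L : ℝ)
    (x : EuclideanSpace ℝ (Fin 2)) : ℝ :=
  ∑' i : ℕ × ℕ, sineCoeff ρ L i.1 i.2 / sqrtLaplaceSymbol L i.1 i.2 * sineMode L i.1 i.2 x

section

variable {ρ : EuclideanSpace ℝ (Fin 2) → ℝ}

lemma summable_sineCoeff_div (hρ : ContDiff ℝ (⊤ : ℕ∞) ρ) (hcompact : HasCompactSupport ρ)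
    {L : ℝ} (hL : 0 < L) (hsupp : tsupport ρ ⊆ box L) :
    Summable fun i : ℕ × ℕ => |sineCoeff ρ L i.1 i.2 / sqrtLaplaceSymbol L i.1 i.2| := by
  obtain ⟨D, -, h⟩ := exists_tail_majorant hρ hcompact le_rfl
  -- For `N = 1` the retained index set is empty, so the tail is the whole series.
  obtain ⟨w, s, hw, -, -, hb⟩ := h L hL hsupp 1 one_pos
  exact Summable.of_nonneg_of_le (fun i => abs_nonneg _) (fun i => hb i.1 i.2 (by simp)) hw.summable

lemma hasSum_sineSeries (hρ : ContDiff ℝ (⊤ : ℕ∞) ρ) (hcompact : HasCompactSupport ρ)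
    {L : ℝ} (hL : 0 < L) (hsupp : tsupport ρ ⊆ box L) (x : EuclideanSpace ℝ (Fin 2)) :
    HasSum (fun i : ℕ × ℕ => sineCoeff ρ L i.1 i.2 / sqrtLaplaceSymbol L i.1 i.2 *
      sineMode L i.1 i.2 x) (sineSeries ρ L x) := by
  refine Summable.hasSum (Summable.of_norm_bounded (summable_sineCoeff_div hρ hcompact hL hsupp)
    fun i => ?_)
  rw [norm_mul]
  exact mul_le_of_le_one_right (norm_nonneg _) (abs_sineMode_le_one L _ _ x)

/-- The mesh error is smaller than every power of the mesh size. -/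
lemma exists_abs_sineSeries_sub_sineSolution_le (hρ : ContDiff ℝ (⊤ : ℕ∞) ρ)
    (hcompact : HasCompactSupport ρ) {k : ℕ} (hk : 1 ≤ k) :
    ∃ D : ℝ, 0 < D ∧ ∀ L : ℝ, 0 < L → tsupport ρ ⊆ box L → ∀ N : ℕ, 0 < N → ∀ x,
      |sineSeries ρ L x - sineSolution ρ L N x| ≤ D * meshSize L N ^ k := by
  obtain ⟨D, hD, h⟩ := exists_tail_majorant hρ hcompact hk
  refine ⟨D, hD, fun L hL hsupp N hN x => ?_⟩
  obtain ⟨w, s, hw, hs, hw0, hb⟩ := h L hL hsupp N hN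
  refine le_trans ?_ hs
  set F := Finset.Icc 1 (N - 1) ×ˢ Finset.Icc 1 (N - 1) with hF
  set t : ℕ × ℕ → ℝ := fun i => sineCoeff ρ L i.1 i.2 / sqrtLaplaceSymbol L i.1 i.2 *
    sineMode L i.1 i.2 x with ht
  have h1 : HasSum (fun i => if i ∈ F then t i else 0) (sineSolution ρ L N x) := by
    have : sineSolution ρ L N x = ∑ i ∈ F, if i ∈ F then t i else 0 := by
      rw [Finset.sum_congr rfl fun i hi => if_pos hi, hF, Finset.sum_product]
      rfl
    rw [this]
    exact hasSum_sum_of_ne_finset_zero fun i hi => if_neg hi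
  refine ((hasSum_sineSeries hρ hcompact hL hsupp x).sub h1).norm_le_of_bounded hw fun i => ?_
  by_cases hi : i ∈ F
  · rw [if_pos hi, sub_self, norm_zero]
    exact hw0 i
  · rw [if_neg hi, sub_zero, norm_mul]
    exact (mul_le_of_le_one_right (norm_nonneg _) (abs_sineMode_le_one L _ _ x)).trans
      (hb i.1 i.2 hi)

lemma hasSum_heatDirichlet_mul {σ L : ℝ} (hσ : 0 < σ) (hL : 0 < L)
    (x y : EuclideanSpace ℝ (Fin 2)) :
    HasSum (fun i : ℕ × ℕ => Real.exp (-(σ * (Real.pi * i.1 / 2)) ^ 2) *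
      Real.exp (-(σ * (Real.pi * i.2 / 2)) ^ 2) * (sineMode L i.1 i.2 x * sineMode L i.1 i.2 y))
      (heatDirichlet σ (x 0 / L) (y 0 / L) * heatDirichlet σ (x 1 / L) (y 1 / L)) := by
  have h0 := hasSum_heatDirichlet hσ (x 0 / L) (y 0 / L)
  have h1 := hasSum_heatDirichlet hσ (x 1 / L) (y 1 / L)
  have e : ∀ (p : ℕ) (z : ℝ), Real.pi * p / 2 * (z / L + 1) = sineFreq L p * (z + L) := by
    intro p z
    rw [sineFreq]
    field_simp
  simp only [e] at h0 h1
  have h := h0.mul h1 (summable_mul_of_summable_norm h0.summable.norm h1.summable.norm)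
  convert! h using 2 with i
  simp only [sineMode]
  ring

lemma hasSum_integral_heatDirichlet (hρ : Continuous ρ) (hcompact : HasCompactSupport ρ)
    {σ L : ℝ} (hσ : 0 < σ) (hL : 0 < L) (x : EuclideanSpace ℝ (Fin 2)) :
    HasSum (fun i : ℕ × ℕ => Real.exp (-((Real.pi * i.1 / 2) ^ 2 + (Real.pi * i.2 / 2) ^ 2) * σ ^ 2) *
      (sineMode L i.1 i.2 x * ∫ y, ρ y * sineMode L i.1 i.2 y))
      (∫ y, ρ y * (heatDirichlet σ (x 0 / L) (y 0 / L) * heatDirichlet σ (x 1 / L) (y 1 / L))) := by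
  have hρi : Integrable ρ := hρ.integrable_of_hasCompactSupport hcompact
  set e : ℕ × ℕ → ℝ := fun i => Real.exp (-(σ * (Real.pi * i.1 / 2)) ^ 2) *
    Real.exp (-(σ * (Real.pi * i.2 / 2)) ^ 2) with he
  have he0 : ∀ i, 0 ≤ e i := fun i => by positivity
  have hes : Summable e := (summable_exp_neg_sq hσ).mul_of_nonneg (summable_exp_neg_sq hσ)
    (fun _ => (Real.exp_pos _).le) (fun _ => (Real.exp_pos _).le)
  set t : ℕ × ℕ → EuclideanSpace ℝ (Fin 2) → ℝ := fun i y =>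
    ρ y * (e i * (sineMode L i.1 i.2 x * sineMode L i.1 i.2 y)) with ht
  have hint : ∀ i, Integrable (t i) := fun i => by
    have := (contDiff_sineMode L i.1 i.2).continuous
    exact Continuous.integrable_of_hasCompactSupport (by fun_prop) hcompact.mul_right
  have hbd : ∀ i y, ‖t i y‖ ≤ ‖ρ y‖ * e i := by
    intro i y
    simp only [ht]
    rw [norm_mul (ρ y), norm_mul (e i), norm_mul (sineMode L i.1 i.2 x),
      Real.norm_of_nonneg (he0 i)]
    refine mul_le_mul_of_nonneg_left (mul_le_of_le_one_right (he0 i) ?_) (norm_nonneg _)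
    exact mul_le_one₀ (abs_sineMode_le_one L _ _ x) (norm_nonneg _) (abs_sineMode_le_one L _ _ y)
  have hsum : Summable fun i => ∫ y, ‖t i y‖ := by
    refine Summable.of_nonneg_of_le (fun i => integral_nonneg fun y => norm_nonneg _)
      (fun i => ?_) (hes.mul_left (∫ y, ‖ρ y‖))
    rw [← integral_mul_const]
    exact integral_mono (hint i).norm (hρi.norm.mul_const _) (hbd i)
  have h := hasSum_integral_of_summable_integral_norm hint hsum
  have hval : ∀ y, ∑' i, t i y = ρ y *
      (heatDirichlet σ (x 0 / L) (y 0 / L) * heatDirichlet σ (x 1 / L) (y 1 / L)) := fun y =>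
    ((hasSum_heatDirichlet_mul hσ hL x y).mul_left (ρ y)).tsum_eq
  simp only [hval] at h
  convert! h using 2 with i
  rw [← mul_assoc, ← integral_const_mul]
  congr 1 with y
  simp only [ht, he]
  rw [← Real.exp_add]
  ring_nf

/-- Subordination on a single mode; scaling to `[-1,1]²` produces `1/L`. For `p = q = 0` both sides
are 0 by convention. -/
lemma integral_exp_neg_mul_sineFreq {L : ℝ} (hL : 0 < L) (p q : ℕ) :
    ∫ σ in Set.Ioi (0 : ℝ), Real.exp (-((Real.pi * p / 2) ^ 2 + (Real.pi * q / 2) ^ 2) * σ ^ 2) =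
      Real.sqrt Real.pi / 2 * (1 / L) / sqrtLaplaceSymbol L p q := by
  have e : Real.sqrt ((Real.pi * p / 2) ^ 2 + (Real.pi * q / 2) ^ 2) =
      L * sqrtLaplaceSymbol L p q := by
    rw [sqrtLaplaceSymbol, ← Real.sqrt_sq hL.le, ← Real.sqrt_mul (sq_nonneg L),
      Real.sqrt_sq hL.le]
    congr 1
    simp only [sineFreq]
    field_simp
  rw [integral_gaussian_Ioi, Real.sqrt_div Real.pi_pos.le, e, ← div_div]
  ring

/-- The full sine series is obtained by integrating the Dirichlet heat kernel. -/
lemma sineSeries_eq_integral_heat (hρ : ContDiff ℝ (⊤ : ℕ∞) ρ) (hcompact : HasCompactSupport ρ)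
    {L : ℝ} (hL : 0 < L) (hsupp : tsupport ρ ⊆ box L) (x : EuclideanSpace ℝ (Fin 2)) :
    sineSeries ρ L x = 1 / L * (2 / Real.sqrt Real.pi) * ∫ σ in Set.Ioi (0 : ℝ), ∫ y,
      ρ y * (heatDirichlet σ (x 0 / L) (y 0 / L) * heatDirichlet σ (x 1 / L) (y 1 / L)) := by
  have hpi : Real.sqrt Real.pi ≠ 0 := (Real.sqrt_pos.2 Real.pi_pos).ne'
  set c : ℕ × ℕ → ℝ := fun i => sineMode L i.1 i.2 x * ∫ y, ρ y * sineMode L i.1 i.2 y with hc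
  set f : ℕ × ℕ → ℝ → ℝ := fun i σ =>
    Real.exp (-((Real.pi * i.1 / 2) ^ 2 + (Real.pi * i.2 / 2) ^ 2) * σ ^ 2) * c i with hf
  have hint : ∀ i, Integrable (f i) (volume.restrict (Set.Ioi (0 : ℝ))) := by
    rintro ⟨p, q⟩
    rcases Nat.eq_zero_or_pos p with rfl | hp
    -- At `p = q = 0` the exponential is not integrable, but the mode vanishes.
    · have : f (0, q) = 0 := by
        ext σ
        simp [hf, hc, sineMode_zero_left]
      rw [this]
      exact integrable_zero _ _ _
    · have hp' : (0 : ℝ) < p := by exact_mod_cast hp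
      exact ((integrable_exp_neg_mul_sq (by positivity)).mul_const _).restrict
  have hnorm : ∀ i, ∫ σ in Set.Ioi (0 : ℝ), ‖f i σ‖ =
      Real.sqrt Real.pi / 2 * (1 / L) / sqrtLaplaceSymbol L i.1 i.2 * |c i| := by
    intro i
    rw [← integral_exp_neg_mul_sineFreq hL, ← integral_mul_const]
    congr 1 with σ
    rw [norm_mul, Real.norm_of_nonneg (Real.exp_pos _).le, Real.norm_eq_abs]
  have hsum : Summable fun i => ∫ σ in Set.Ioi (0 : ℝ), ‖f i σ‖ := by
    refine Summable.of_nonneg_of_le (fun i => integral_nonneg fun y => norm_nonneg _)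
      (fun i => ?_) ((summable_sineCoeff_div hρ hcompact hL hsupp).mul_left
        (Real.sqrt Real.pi / 2 * L))
    have hsy : 0 ≤ sqrtLaplaceSymbol L i.1 i.2 := Real.sqrt_nonneg _
    rw [hnorm, sineCoeff_eq hsupp, abs_div, abs_of_nonneg hsy, abs_mul (1 / L ^ 2),
      abs_of_nonneg (by positivity : 0 ≤ 1 / L ^ 2)]
    simp only [hc]
    rw [abs_mul]
    calc Real.sqrt Real.pi / 2 * (1 / L) / sqrtLaplaceSymbol L i.1 i.2 *
          (|sineMode L i.1 i.2 x| * |∫ y, ρ y * sineMode L i.1 i.2 y|)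
        ≤ Real.sqrt Real.pi / 2 * (1 / L) / sqrtLaplaceSymbol L i.1 i.2 *
          (1 * |∫ y, ρ y * sineMode L i.1 i.2 y|) := by
          gcongr
          exact abs_sineMode_le_one L _ _ x
      _ = (Real.sqrt Real.pi / 2 * (|∫ y, ρ y * sineMode L i.1 i.2 y| /
          sqrtLaplaceSymbol L i.1 i.2)) * (1 / L) := by ring
      _ = (Real.sqrt Real.pi / 2 * (|∫ y, ρ y * sineMode L i.1 i.2 y| /
          sqrtLaplaceSymbol L i.1 i.2)) * (L * (1 / L ^ 2)) := by
          congr 1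
          field_simp
      _ = _ := by ring
  have h := (hasSum_integral_of_summable_integral_norm hint hsum).mul_left
    (1 / L * (2 / Real.sqrt Real.pi))
  have hval : ∫ σ in Set.Ioi (0 : ℝ), ∑' i, f i σ = ∫ σ in Set.Ioi (0 : ℝ), ∫ y,
      ρ y * (heatDirichlet σ (x 0 / L) (y 0 / L) * heatDirichlet σ (x 1 / L) (y 1 / L)) :=
    setIntegral_congr_fun measurableSet_Ioi fun σ hσ =>
      (hasSum_integral_heatDirichlet hρ.continuous hcompact hσ hL x).tsum_eq
  rw [hval] at h
  refine (hasSum_sineSeries hρ hcompact hL hsupp x).unique ?_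
  convert! h using 2 with i
  simp only [hf]
  rw [integral_mul_const, integral_exp_neg_mul_sineFreq hL, sineCoeff_eq hsupp]
  simp only [hc]
  field_simp

lemma continuous_heatDirichlet {σ : ℝ} (hσ : 0 < σ) (a : ℝ) :
    Continuous fun b => heatDirichlet σ a b := by
  unfold heatDirichlet
  refine continuous_tsum (fun p => by fun_prop) (summable_exp_neg_sq hσ) fun p b => ?_
  rw [norm_mul, Real.norm_eq_abs, Real.abs_exp, norm_mul]
  refine mul_le_of_le_one_right (Real.exp_pos _).le ?_
  exact mul_le_one₀ (Real.abs_sin_le_one _) (norm_nonneg _) (Real.abs_sin_le_one _)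

lemma integrable_mul_heatDirichlet (hρ : Continuous ρ) (hcompact : HasCompactSupport ρ) {σ : ℝ}
    (hσ : 0 < σ) (L : ℝ) (x : EuclideanSpace ℝ (Fin 2)) :
    Integrable fun y =>
      ρ y * (heatDirichlet σ (x 0 / L) (y 0 / L) * heatDirichlet σ (x 1 / L) (y 1 / L)) := by
  refine Continuous.integrable_of_hasCompactSupport ?_ hcompact.mul_right
  have h0 := continuous_heatDirichlet hσ (x 0 / L)
  have h1 := continuous_heatDirichlet hσ (x 1 / L)
  exact hρ.mul ((h0.comp (by fun_prop : Continuous fun y : EuclideanSpace ℝ (Fin 2) => y 0 / L)).mul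
    (h1.comp (by fun_prop : Continuous fun y : EuclideanSpace ℝ (Fin 2) => y 1 / L)))

/-- Measurability in `σ` comes from pointwise convergence of finite sums that are continuous in `σ`.
-/
lemma aestronglyMeasurable_integral_heatDirichlet (hρ : Continuous ρ)
    (hcompact : HasCompactSupport ρ) {L : ℝ} (hL : 0 < L) (x : EuclideanSpace ℝ (Fin 2)) :
    AEStronglyMeasurable (fun σ : ℝ => ∫ y, ρ y * (heatDirichlet σ (x 0 / L) (y 0 / L) *
      heatDirichlet σ (x 1 / L) (y 1 / L))) (volume.restrict (Set.Ioi 0)) := by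
  refine aestronglyMeasurable_of_tendsto_ae (u := Filter.atTop)
    (f := fun (s : Finset (ℕ × ℕ)) (σ : ℝ) => ∑ i ∈ s,
      Real.exp (-((Real.pi * i.1 / 2) ^ 2 + (Real.pi * i.2 / 2) ^ 2) * σ ^ 2) *
      (sineMode L i.1 i.2 x * ∫ y, ρ y * sineMode L i.1 i.2 y)) (fun s => ?_) ?_
  · exact (by fun_prop : Continuous _).aestronglyMeasurable
  · exact (ae_restrict_iff' measurableSet_Ioi).2 (Filter.Eventually.of_forall fun σ hσ =>
      hasSum_integral_heatDirichlet hρ hcompact hσ hL x)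

/-! ### The domain error and the combined estimate. -/

/-- On large squares the full sine series approximates the Coulomb potential to the order given by
the number of vanishing moments. -/
lemma exists_abs_coulombPotential_sub_sineSeries_le {m : ℕ} (hρ : ContDiff ℝ (⊤ : ℕ∞) ρ)
    (hcompact : HasCompactSupport ρ) (hmoments : VanishingMoments m ρ) {R : ℝ} (hR : 0 ≤ R)
    (hsupR : ∀ y i, ρ y ≠ 0 → |y i| ≤ R) :
    ∃ C : ℝ, 0 < C ∧ ∀ L : ℝ, 0 < L → tsupport ρ ⊆ box L → R ≤ 1 / 8 * L → ∀ x ∈ box L,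
      |coulombPotential ρ x - sineSeries ρ L x| ≤ C * (1 / L ^ (m + 2)) := by
  obtain ⟨C, hC, hker⟩ := exists_monomialSumBound_heat_sub
  have hpi : 0 < Real.sqrt Real.pi := Real.sqrt_pos.2 Real.pi_pos
  have hI : 0 ≤ ∫ y, |ρ y| := integral_nonneg fun y => abs_nonneg _
  refine ⟨2 / Real.sqrt Real.pi * (((∫ y, |ρ y|) * C * (8 * R) ^ (m + 1)) * (Real.pi / 2)) + 1,
    by positivity, fun L hL hsupp hRL x hx => ?_⟩
  have hxL : ∀ i, |x i / L| ≤ 1 := by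
    intro i
    rw [abs_div, abs_of_pos hL, div_le_one hL]
    exact abs_le.2 (hx i)
  obtain ⟨K, hK, hKbd⟩ := exists_integral_norm_heat_le hρ.continuous hcompact hL
  set G : ℝ → ℝ := fun σ => ∫ y,
    ρ y * (heatLine σ (x 0 / L - y 0 / L) * heatLine σ (x 1 / L - y 1 / L)) with hG
  set H : ℝ → ℝ := fun σ => ∫ y, ρ y * (heatDirichlet σ (x 0 / L) (y 0 / L) *
    heatDirichlet σ (x 1 / L) (y 1 / L)) with hH
  set Q : ℝ := (∫ y, |ρ y|) * C * (R / (1 / 8 * L)) ^ (m + 1) with hQ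
  have hdiff : ∀ σ : ℝ, 0 < σ → |G σ - H σ| ≤ Q * (1 + σ ^ 2)⁻¹ := by
    intro σ hσ
    have h := (hker σ hσ _ _ (hxL 0) (hxL 1)).abs_integral_le (by norm_num) hρ.continuous hcompact
      hmoments hL hR hRL hsupR
    simp only [hG, hH]
    rw [← integral_sub (integrable_mul_heat hρ.continuous hcompact σ L x)
      (integrable_mul_heatDirichlet hρ.continuous hcompact hσ L x)]
    simp only [← mul_sub]
    refine h.trans (le_of_eq ?_)
    rw [hQ]
    ring
  have hGi : IntegrableOn G (Set.Ioi 0) := integrableOn_integral_heat hρ.continuous hcompact hL x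
  -- Domination of `H` by the bound for `G` plus that for `G - H`.
  have hHi : IntegrableOn H (Set.Ioi 0) := by
    refine Integrable.mono' ((integrable_inv_one_add_sq.const_mul (K + Q)).restrict)
      (aestronglyMeasurable_integral_heatDirichlet hρ.continuous hcompact hL x) ?_
    refine (ae_restrict_iff' measurableSet_Ioi).2 (Filter.Eventually.of_forall fun σ hσ => ?_)
    have h1 : |G σ| ≤ K * (1 + σ ^ 2)⁻¹ :=
      (norm_integral_le_integral_norm _).trans (hKbd x σ hσ)
    have h2 := hdiff σ hσ
    have h3 := abs_sub_abs_le_abs_sub (H σ) (G σ)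
    rw [abs_sub_comm (H σ)] at h3
    change |H σ| ≤ _
    linarith
  rw [coulombPotential_eq_integral_heat hρ.continuous hcompact hL x,
    sineSeries_eq_integral_heat hρ hcompact hL hsupp x, ← mul_sub, ← integral_sub hGi hHi, abs_mul,
    abs_of_nonneg (by positivity : 0 ≤ 1 / L * (2 / Real.sqrt Real.pi))]
  have hmain := abs_setIntegral_le_of_le_inv_one_add_sq hdiff
  calc 1 / L * (2 / Real.sqrt Real.pi) * |∫ σ in Set.Ioi (0 : ℝ), (G σ - H σ)|
      ≤ 1 / L * (2 / Real.sqrt Real.pi) * (Q * (Real.pi / 2)) := by gcongr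
    _ = 2 / Real.sqrt Real.pi * (((∫ y, |ρ y|) * C * (8 * R) ^ (m + 1)) * (Real.pi / 2)) *
        (1 / L ^ (m + 2)) := by
        rw [hQ, show R / (1 / 8 * L) = (8 * R) / L by field_simp, div_pow]
        field_simp
        ring
    _ ≤ _ := by
        refine mul_le_mul_of_nonneg_right ?_ (by positivity)
        linarith

lemma exists_abs_coulombPotential_sub_sineSolution_le {m : ℕ} (hρ : ContDiff ℝ (⊤ : ℕ∞) ρ)
    (hcompact : HasCompactSupport ρ) (hmoments : VanishingMoments m ρ) :
    ∃ C : ℝ, 0 < C ∧ ∀ k : ℕ, 1 ≤ k → ∃ D : ℝ, 0 < D ∧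
      ∀ L : ℝ, 0 < L → tsupport ρ ⊆ box L → ∀ N : ℕ, 0 < N → ∀ x ∈ box L,
        |coulombPotential ρ x - sineSolution ρ L N x| ≤
          C * (1 / L ^ (m + 2)) + D * meshSize L N ^ k := by
  obtain ⟨R, hR0, hR⟩ : ∃ R : ℝ, 0 < R ∧ ∀ y ∈ tsupport ρ, ‖y‖ ≤ R :=
    hcompact.isCompact.isBounded.exists_pos_norm_le
  have hsupR : ∀ y i, ρ y ≠ 0 → |y i| ≤ R := fun y i h =>
    (PiLp.norm_apply_le y i).trans (hR y (subset_tsupport ρ h))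
  obtain ⟨C, hC, hlarge⟩ :=
    exists_abs_coulombPotential_sub_sineSeries_le hρ hcompact hmoments hR0.le hsupR
  obtain ⟨K, hK, hφ⟩ := exists_abs_coulombPotential_le hρ.continuous hcompact
  obtain ⟨D₁, hD₁, hmesh₁⟩ := exists_abs_sineSeries_sub_sineSolution_le hρ hcompact le_rfl
  have hfull : ∀ L : ℝ, 0 < L → tsupport ρ ⊆ box L → ∀ x ∈ box L,
      |coulombPotential ρ x - sineSeries ρ L x| ≤
        (C + (K + 16 * D₁ * R) * (8 * R) ^ (m + 2)) * (1 / L ^ (m + 2)) := by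
    intro L hL hsupp x hx
    rcases le_total R (1 / 8 * L) with h | h
    · refine (hlarge L hL hsupp h x hx).trans (mul_le_mul_of_nonneg_right ?_ (by positivity))
      have : 0 ≤ (K + 16 * D₁ * R) * (8 * R) ^ (m + 2) := by positivity
      linarith
    -- Small squares: both terms are bounded, and `1 ≤ (8R/L)^(m+2)`. The series is bounded by its
    -- mesh error at `N = 1`, where the truncated sum is empty and the mesh size is `2L`.
    · have hL8 : L ≤ 8 * R := by linarith
      have h1 := hmesh₁ L hL hsupp 1 one_pos x
      have h0 : sineSolution ρ L 1 x = 0 := by simp [sineSolution]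
      rw [h0, sub_zero, pow_one, meshSize, Nat.cast_one, div_one] at h1
      have h2 : D₁ * (2 * L) ≤ 16 * D₁ * R := by nlinarith
      have h3 : 1 ≤ (8 * R) ^ (m + 2) * (1 / L ^ (m + 2)) := by
        rw [mul_one_div, ← div_pow]
        exact one_le_pow₀ ((one_le_div hL).2 hL8)
      have h4 : 0 ≤ 1 / L ^ (m + 2) := by positivity
      calc |coulombPotential ρ x - sineSeries ρ L x|
          ≤ |coulombPotential ρ x| + |sineSeries ρ L x| := abs_sub _ _
        _ ≤ K + 16 * D₁ * R := add_le_add (hφ x) (h1.trans h2)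
        _ ≤ (K + 16 * D₁ * R) * ((8 * R) ^ (m + 2) * (1 / L ^ (m + 2))) :=
            le_mul_of_one_le_right (by positivity) h3
        _ ≤ _ := by nlinarith [mul_nonneg hC.le h4]
  refine ⟨C + (K + 16 * D₁ * R) * (8 * R) ^ (m + 2), by positivity, fun k hk => ?_⟩
  obtain ⟨D, hD, hmesh⟩ := exists_abs_sineSeries_sub_sineSolution_le hρ hcompact hk
  refine ⟨D, hD, fun L hL hsupp N hN x hx => ?_⟩
  exact (abs_sub_le _ (sineSeries ρ L x) _).trans
    (add_le_add (hfull L hL hsupp x hx) (hmesh L hL hsupp N hN x))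

end

/-! ### Supremum norms and the resolved regime. -/

lemma supNormOn_le {Ω : Set (EuclideanSpace ℝ (Fin 2))} {f : EuclideanSpace ℝ (Fin 2) → ℝ} {B : ℝ}
    (h : ∀ x ∈ Ω, |f x| ≤ B) : supNormOn Ω f ≤ ENNReal.ofReal B :=
  iSup₂_le fun x hx => ENNReal.ofReal_le_ofReal (h x hx)

/-- For `L ≥ 1` the mesh condition gives `h^k ≤ L^(-εk)`. For `L ≤ 1` it is useless, but `N ≥ 2`
forces `h ≤ L ≤ 1 ≤ L^(-(m+2))`. -/
lemma meshSize_pow_le {L ε : ℝ} {N m k : ℕ} (hL : 0 < L) (hN : 2 ≤ N) (hk : (m + 2 : ℝ) ≤ ε * k)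
    (hh : meshSize L N ≤ L ^ (-ε)) : meshSize L N ^ k ≤ 1 / L ^ (m + 2) := by
  have hN' : (2 : ℝ) ≤ N := by exact_mod_cast hN
  have h0 : 0 ≤ meshSize L N := by unfold meshSize; positivity
  rcases le_total 1 L with h1 | h1
  · calc meshSize L N ^ k ≤ (L ^ (-ε)) ^ k := by gcongr
      _ = L ^ (-(ε * k)) := by rw [← Real.rpow_natCast, ← Real.rpow_mul hL.le, neg_mul]
      _ ≤ L ^ (-((m + 2 : ℕ) : ℝ)) := by
          apply Real.rpow_le_rpow_of_exponent_le h1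
          push_cast
          linarith
      _ = 1 / L ^ (m + 2) := by rw [Real.rpow_neg hL.le, Real.rpow_natCast, one_div]
  · have h2 : meshSize L N ≤ 1 := by
      rw [meshSize, div_le_one (by linarith)]
      linarith
    refine (pow_le_one₀ h0 h2).trans ?_
    rw [one_le_div (by positivity)]
    exact pow_le_one₀ hL.le h1

theorem theorem2 (m : ℕ) (ρ : EuclideanSpace ℝ (Fin 2) → ℝ)
    (hsmooth : ContDiff ℝ (⊤ : ℕ∞) ρ) (hcompact : HasCompactSupport ρ)
    (hmoments : VanishingMoments m ρ) :
    (∀ x, Integrable (fun y => coulombKernel (x - y) * ρ y)) ∧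
    (∃ C : ℝ, 0 < C ∧ ∀ k : ℕ, 1 ≤ k → ∃ D : ℝ, 0 < D ∧
      ∀ L : ℝ, 0 < L → tsupport ρ ⊆ box L → ∀ N : ℕ, 0 < N → Even N →
        supNormOn (box L) (fun x => coulombPotential ρ x - sineSolution ρ L N x) ≤
          ENNReal.ofReal (C * (1 / L ^ (m + 2)) + D * meshSize L N ^ k)) ∧
    (∀ ε : ℝ, 0 < ε → ∃ C : ℝ, 0 < C ∧
      ∀ L : ℝ, 0 < L → tsupport ρ ⊆ box L → ∀ N : ℕ, 0 < N → Even N →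
        meshSize L N ≤ L ^ (-ε) →
        supNormOn (box L) (fun x => coulombPotential ρ x - sineSolution ρ L N x) ≤
          ENNReal.ofReal (C * (1 / L ^ (m + 2)))) := by
  obtain ⟨C, hC, hmain⟩ :=
    exists_abs_coulombPotential_sub_sineSolution_le hsmooth hcompact hmoments
  refine ⟨integrable_coulombKernel_mul hsmooth.continuous hcompact, ⟨C, hC, fun k hk => ?_⟩,
    fun ε hε => ?_⟩
  · obtain ⟨D, hD, h⟩ := hmain k hk
    exact ⟨D, hD, fun L hL hsupp N hN _ => supNormOn_le (h L hL hsupp N hN)⟩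
  · obtain ⟨k, hk⟩ := exists_nat_ge ((m + 2 : ℝ) / ε)
    have hk' : (m + 2 : ℝ) ≤ ε * k := by rwa [div_le_iff₀' hε] at hk
    have hk1 : 1 ≤ k := by
      rw [Nat.one_le_iff_ne_zero]
      rintro rfl
      rw [Nat.cast_zero, mul_zero] at hk'
      linarith [(Nat.cast_nonneg m : (0 : ℝ) ≤ m)]
    obtain ⟨D, hD, h⟩ := hmain k hk1
    refine ⟨C + D, by positivity, fun L hL hsupp N hN hNe hh => supNormOn_le fun x hx => ?_⟩
    have hN2 : 2 ≤ N := by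
      obtain ⟨j, rfl⟩ := hNe
      omega
    have hpow := mul_le_mul_of_nonneg_left (meshSize_pow_le hL hN2 hk' hh) hD.le
    calc |coulombPotential ρ x - sineSolution ρ L N x|
        ≤ C * (1 / L ^ (m + 2)) + D * meshSize L N ^ k := h L hL hsupp N hN x hx
      _ ≤ (C + D) * (1 / L ^ (m + 2)) := by rw [add_mul]; linarith
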